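/- Let $\mathcal A$ be the antitree with sphere numbers $s_n=n+1$, $n\ge 0$: its vertex set is the disjoint union of the sets $S_n$ with $\#S_n=n+1$, $n\in\mathbb Z_{\ge 0}$, and two vertices are joined by an edge if and only if they lie in consecutive sets $S_n$, $S_{n+1}$. Given a length $|e|\in(0,\infty)$ for every edge $e$, direct the edges arbitrarily and identify each $e$ with the interval $[0,|e|]$; put $L^2(\mathcal A)=\bigoplus_e L^2(e)$ (complex-valued functions). The minimal Kirchhoff Laplacian $\mathbf H_0$ is the closure in $L^2(\mathcal A)$ of the operator $f\mapsto -f''$ (edgewise) defined on those $f\in L^2(\mathcal A)$ that vanish on all but finitely many edges, belong to $H^2(e)$ for every edge $e$ and satisfy the Kirchhoff conditions at every vertex $v$: $f$ is continuous at $v$, and the sum of the derivatives of $f$ at $v$, taken along all edges incident to $v$ in the direction out of $v$, is zero. Its deficiency indices are $\mathrm n_\pm(\mathbf H_0)=\dim\ker(\mathbf H_0^*\mp \mathrm i)\in\mathbb Z_{\ge 0}\cup\{\infty\}$. Theorem. For every $N\in\mathbb Z_{\ge 1}\cup\{\infty\}$ there are edge lengths $|e|\in(0,\infty)$ such that the minimal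 Kirchhoff Laplacian $\mathbf H_0$ on the resulting metric antitree satisfies $\mathrm n_+(\mathbf H_0)=\mathrm n_-(\mathbf H_0)=N$. -/

import Mathlib

open MeasureTheory Set

noncomputable section

namespace QuantumGraph

/-! ### Sobolev spaces on an interval -/

/-- `f` belongs to `H¹(0, L)`: it is absolutely continuous on `[0, L]` and `f' ∈ L²(0, L)`.
Only the values of `f` on `[0, L]` matter. -/
def MemH1 (L : ℝ) (f : ℝ → ℂ) : Prop :=
  AbsolutelyContinuousOnInterval f 0 L ∧
    MemLp (derivWithin f (Icc 0 L)) 2 (volume.restrict (Icc 0 L))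

/-- `f` belongs to `H²(0, L)`: both `f` and `f'` belong to `H¹(0, L)`. -/
def MemH2 (L : ℝ) (f : ℝ → ℂ) : Prop :=
  MemH1 L f ∧ MemH1 L (derivWithin f (Icc 0 L))

/-- The second derivative on `[0, L]`. -/
def secondDeriv (L : ℝ) (f : ℝ → ℂ) : ℝ → ℂ :=
  derivWithin (derivWithin f (Icc 0 L)) (Icc 0 L)

/-- An absolutely continuous function is differentiable almost everywhere. -/
theorem ae_differentiableWithinAt {L : ℝ} (hL : 0 < L) {f : ℝ → ℂ}
    (hf : AbsolutelyContinuousOnInterval f 0 L) :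
    ∀ᵐ x ∂(volume.restrict (Icc 0 L)), DifferentiableWithinAt ℝ f (Icc 0 L) x := by
  rw [ae_restrict_iff' measurableSet_Icc]
  filter_upwards [hf.boundedVariationOn.ae_differentiableAt_of_mem_uIcc] with x hx hxI
  exact (hx (by rwa [uIcc_of_le hL.le])).differentiableWithinAt

/-- Functions in `H²(0, L)` are differentiable everywhere on `[0, L]`. -/
theorem MemH2.differentiableOn {L : ℝ} (hL : 0 < L) {f : ℝ → ℂ} (hf : MemH2 L f) :
    DifferentiableOn ℝ f (Icc 0 L) := by
  set g := derivWithin f (Icc 0 L) with hg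
  have hgc : ContinuousOn g (Icc 0 L) := by
    have := hf.2.1.continuousOn
    rwa [uIcc_of_le hL.le] at this
  have hG : ∀ x ∈ Icc (0 : ℝ) L,
      HasDerivWithinAt (fun y => ∫ t in (0 : ℝ)..y, g t) (g x) (Icc 0 L) x := by
    intro x hx
    have : Fact (x ∈ Icc (0 : ℝ) L) := ⟨hx⟩
    refine intervalIntegral.integral_hasDerivWithinAt_right ?_ ?_ (hgc x hx)
    · refine (hgc.mono ?_).intervalIntegrable
      rw [uIcc_of_le hx.1]
      exact Icc_subset_Icc_right hx.2
    · exact hgc.stronglyMeasurableAtFilter_nhdsWithin measurableSet_Icc x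
  have hGd : ∀ x ∈ Icc (0 : ℝ) L,
      derivWithin (fun y => ∫ t in (0 : ℝ)..y, g t) (Icc 0 L) x = g x := fun x hx =>
    (hG x hx).derivWithin (uniqueDiffOn_Icc hL x hx)
  have hGac : AbsolutelyContinuousOnInterval (fun y => ∫ t in (0 : ℝ)..y, g t) 0 L := by
    apply ContDiffOn.absolutelyContinuousOnInterval
    rw [uIcc_of_le hL.le, contDiffOn_one_iff_derivWithin (uniqueDiffOn_Icc hL)]
    exact ⟨fun x hx => (hG x hx).differentiableWithinAt, hgc.congr hGd⟩
  obtain ⟨C, hC⟩ := (hf.1.1.sub hGac).const_of_ae_hasDerivAt_zero (by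
    have h0 : ∀ᵐ x : ℝ, x ≠ 0 := by simp [ae_iff, measure_singleton]
    have h1 : ∀ᵐ x : ℝ, x ≠ L := by simp [ae_iff, measure_singleton]
    filter_upwards [hf.1.1.boundedVariationOn.ae_differentiableAt_of_mem_uIcc, h0, h1]
      with x hx hx0 hx1 hxI
    have hd := (hx hxI).hasDerivAt
    rw [uIcc_of_le hL.le] at hxI
    have hn : Icc (0 : ℝ) L ∈ nhds x :=
      Icc_mem_nhds (lt_of_le_of_ne hxI.1 (Ne.symm hx0)) (lt_of_le_of_ne hxI.2 hx1)
    have h2 := hd.sub ((hG x hxI).hasDerivAt hn)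
    rwa [hg, derivWithin_of_mem_nhds hn, sub_self] at h2)
  rw [uIcc_of_le hL.le] at hC
  intro x hx
  refine (((hG x hx).const_add C).differentiableWithinAt).congr (fun y hy => ?_) ?_
  · have := hC y hy
    simp only [Pi.sub_apply] at this
    rw [← this]; ring
  · have := hC x hx
    simp only [Pi.sub_apply] at this
    rw [← this]; ring

theorem derivWithin_congr_Icc {L : ℝ} {f g : ℝ → ℂ} (h : EqOn f g (Icc 0 L)) :
    EqOn (derivWithin f (Icc 0 L)) (derivWithin g (Icc 0 L)) (Icc 0 L) :=
  fun _ hx => derivWithin_congr h (h hx)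

theorem absolutelyContinuous_congr {L : ℝ} (hL : 0 < L) {f g : ℝ → ℂ}
    (h : EqOn f g (Icc 0 L)) (hf : AbsolutelyContinuousOnInterval f 0 L) :
    AbsolutelyContinuousOnInterval g 0 L := by
  rw [absolutelyContinuousOnInterval_iff] at hf ⊢
  intro ε hε
  obtain ⟨δ, hδ, H⟩ := hf ε hε
  refine ⟨δ, hδ, fun E hE hE' => ?_⟩
  have := H E hE hE'
  rw [← uIcc_of_le hL.le] at h
  rwa [Finset.sum_congr rfl (g := fun i => dist (f (E.2 i).1) (f (E.2 i).2))]
  intro i hi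
  rw [h (hE.1 i hi).1, h (hE.1 i hi).2]

theorem derivWithin_add_eqOn {L : ℝ} {f g : ℝ → ℂ}
    (hf : DifferentiableOn ℝ f (Icc 0 L)) (hg : DifferentiableOn ℝ g (Icc 0 L)) :
    EqOn (derivWithin (f + g) (Icc 0 L))
      (derivWithin f (Icc 0 L) + derivWithin g (Icc 0 L)) (Icc 0 L) :=
  fun x hx => derivWithin_add (hf x hx) (hg x hx)

theorem derivWithin_smul_eqOn {L : ℝ} (c : ℂ) {f : ℝ → ℂ}
    (hf : DifferentiableOn ℝ f (Icc 0 L)) :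
    EqOn (derivWithin (c • f) (Icc 0 L)) (c • derivWithin f (Icc 0 L)) (Icc 0 L) :=
  fun x hx => derivWithin_const_smul c (hf x hx)

theorem secondDeriv_add {L : ℝ} (hL : 0 < L) {f g : ℝ → ℂ} (hf : MemH2 L f) (hg : MemH2 L g) :
    secondDeriv L (f + g) =ᵐ[volume.restrict (Icc 0 L)] secondDeriv L f + secondDeriv L g := by
  filter_upwards [ae_differentiableWithinAt hL hf.2.1, ae_differentiableWithinAt hL hg.2.1,
    ae_restrict_mem measurableSet_Icc] with x h1 h2 hx
  have h := derivWithin_congr_Icc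
    (derivWithin_add_eqOn (hf.differentiableOn hL) (hg.differentiableOn hL)) hx
  simp only [secondDeriv, Pi.add_apply]
  rw [h]
  exact derivWithin_add h1 h2

theorem secondDeriv_smul {L : ℝ} (hL : 0 < L) (c : ℂ) {f : ℝ → ℂ} (hf : MemH2 L f) :
    secondDeriv L (c • f) =ᵐ[volume.restrict (Icc 0 L)] c • secondDeriv L f := by
  filter_upwards [ae_differentiableWithinAt hL hf.2.1,
    ae_restrict_mem measurableSet_Icc] with x h1 hx
  have h := derivWithin_congr_Icc (derivWithin_smul_eqOn c (hf.differentiableOn hL)) hx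
  simp only [secondDeriv, Pi.smul_apply]
  rw [h]
  exact derivWithin_const_smul c h1

theorem MemH2.add {L : ℝ} (hL : 0 < L) {f g : ℝ → ℂ} (hf : MemH2 L f) (hg : MemH2 L g) :
    MemH2 L (f + g) := by
  have h := derivWithin_add_eqOn (hf.differentiableOn hL) (hg.differentiableOn hL)
  refine ⟨⟨hf.1.1.add hg.1.1, (hf.1.2.add hg.1.2).ae_eq ?_⟩,
    absolutelyContinuous_congr hL h.symm (hf.2.1.add hg.2.1), (hf.2.2.add hg.2.2).ae_eq ?_⟩
  · filter_upwards [ae_restrict_mem measurableSet_Icc] with x hx using (h hx).symm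
  · exact (secondDeriv_add hL hf hg).symm

theorem MemH2.smul {L : ℝ} (hL : 0 < L) (c : ℂ) {f : ℝ → ℂ} (hf : MemH2 L f) :
    MemH2 L (c • f) := by
  have h := derivWithin_smul_eqOn c (hf.differentiableOn hL)
  refine ⟨⟨hf.1.1.const_smul c, (hf.1.2.const_smul c).ae_eq ?_⟩,
    absolutelyContinuous_congr hL h.symm (hf.2.1.const_smul c), (hf.2.2.const_smul c).ae_eq ?_⟩
  · filter_upwards [ae_restrict_mem measurableSet_Icc] with x hx using (h hx).symm
  · exact (secondDeriv_smul hL c hf).symm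

theorem absolutelyContinuous_zero (L : ℝ) :
    AbsolutelyContinuousOnInterval (0 : ℝ → ℂ) 0 L := by
  rw [absolutelyContinuousOnInterval_iff]
  exact fun ε hε => ⟨1, one_pos, fun E _ _ => by simpa using hε⟩

theorem derivWithin_zero_fun (L : ℝ) : derivWithin (0 : ℝ → ℂ) (Icc 0 L) = 0 :=
  derivWithin_const (Icc 0 L) (0 : ℂ)

theorem MemH2.zero (L : ℝ) : MemH2 L 0 := by
  refine ⟨⟨absolutelyContinuous_zero L, ?_⟩, ?_, ?_⟩ <;>
    simp only [derivWithin_zero_fun]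
  · exact MemLp.zero
  · exact absolutelyContinuous_zero L
  · exact MemLp.zero

theorem secondDeriv_zero (L : ℝ) : secondDeriv L 0 = 0 := by
  simp [secondDeriv]

/-- A function in `H²(0, L)` that vanishes almost everywhere has vanishing second derivative. -/
theorem secondDeriv_eq_zero {L : ℝ} (hL : 0 < L) {f : ℝ → ℂ} (hf : MemH2 L f)
    (h0 : f =ᵐ[volume.restrict (Icc 0 L)] 0) : EqOn (secondDeriv L f) 0 (Icc 0 L) := by
  have hc : ContinuousOn f (Icc 0 L) := by
    have := hf.1.1.continuousOn
    rwa [uIcc_of_le hL.le] at this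
  have h : EqOn f 0 (Icc 0 L) :=
    Measure.eqOn_Icc_of_ae_eq volume hL.ne h0 hc continuousOn_const
  intro x hx
  have := derivWithin_congr_Icc (derivWithin_congr_Icc h) hx
  rw [secondDeriv, this]
  simp

/-! ### Metric graphs -/

variable {V : Type*} {G : SimpleGraph V}

/-- An assignment of a direction to every edge of a graph. -/
structure Orientation (G : SimpleGraph V) where
  tail : G.edgeSet → V
  head : G.edgeSet → V
  mk_eq : ∀ e, s(tail e, head e) = e.1

instance : Nonempty (Orientation G) :=
  ⟨⟨fun e => (Quot.out e.1).1, fun e => (Quot.out e.1).2, fun e => Quot.out_eq e.1⟩⟩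

/-- The Hilbert space `L²(𝒢) = ⨁ₑ L²(e)` of the metric graph with edge lengths `ℓ`, where the
edge `e` is identified with the interval `[0, ℓ e]`. -/
abbrev L2 (G : SimpleGraph V) (ℓ : G.edgeSet → ℝ) : Type _ :=
  lp (fun e : G.edgeSet => Lp ℂ 2 (volume.restrict (Icc 0 (ℓ e)))) 2

/-- The subspace `L²_c(𝒢)` of the functions that vanish on all but finitely many edges. -/
def L2c (G : SimpleGraph V) (ℓ : G.edgeSet → ℝ) : Submodule ℂ (L2 G ℓ) where
  carrier := {u | {e | u e ≠ 0}.Finite}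
  zero_mem' := by simp
  add_mem' {u v} hu hv := by
    refine (Set.Finite.union hu hv).subset fun e he => ?_
    by_contra h
    simp only [mem_union, mem_ofPred_eq, not_or, not_not] at h
    exact he (by simp [h.1, h.2])
  smul_mem' c u hu := by
    refine Set.Finite.subset hu fun e he h => he ?_
    simp [h]

open scoped Classical in
/-- The value `f_e(v)` at an endpoint `v` of the edge `e`. The tail of `e` is the left endpoint
of `[0, ℓ e]` and the head is the right endpoint. -/
def vertexValue (o : Orientation G) (ℓ : G.edgeSet → ℝ) (f : G.edgeSet → ℝ → ℂ)
    (e : G.edgeSet) (v : V) : ℂ :=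
  if v = o.tail e then f e 0 else f e (ℓ e)

open scoped Classical in
/-- The derivative `f_e'(v)` at an endpoint `v` of the edge `e`, in the direction pointing from
`v` into the edge. -/
def vertexDeriv (o : Orientation G) (ℓ : G.edgeSet → ℝ) (f : G.edgeSet → ℝ → ℂ)
    (e : G.edgeSet) (v : V) : ℂ :=
  if v = o.tail e then derivWithin (f e) (Icc 0 (ℓ e)) 0
  else -derivWithin (f e) (Icc 0 (ℓ e)) (ℓ e)

/-- The edge joining `v` to a neighbour `w`. -/
def starEdge (v : V) (w : G.neighborSet v) : G.edgeSet := ⟨s(v, w.1), w.2⟩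

/-- The Kirchhoff conditions at the vertex `v`: `f` is continuous at `v`, and the outgoing
derivatives along the edges incident to `v` sum up to zero. -/
def Kirchhoff [G.LocallyFinite] (o : Orientation G) (ℓ : G.edgeSet → ℝ)
    (f : G.edgeSet → ℝ → ℂ) (v : V) : Prop :=
  (∀ w w' : G.neighborSet v,
    vertexValue o ℓ f (starEdge v w) v = vertexValue o ℓ f (starEdge v w') v) ∧
  ∑ w : G.neighborSet v, vertexDeriv o ℓ f (starEdge v w) v = 0

theorem vertexValue_add (o : Orientation G) (ℓ : G.edgeSet → ℝ) (f g : G.edgeSet → ℝ → ℂ)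
    (e : G.edgeSet) (v : V) :
    vertexValue o ℓ (f + g) e v = vertexValue o ℓ f e v + vertexValue o ℓ g e v := by
  unfold vertexValue; split_ifs <;> rfl

theorem vertexValue_smul (o : Orientation G) (ℓ : G.edgeSet → ℝ) (c : ℂ)
    (f : G.edgeSet → ℝ → ℂ) (e : G.edgeSet) (v : V) :
    vertexValue o ℓ (c • f) e v = c * vertexValue o ℓ f e v := by
  unfold vertexValue; split_ifs <;> rfl

theorem vertexDeriv_add (o : Orientation G) {ℓ : G.edgeSet → ℝ} (hℓ : ∀ e, 0 < ℓ e)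
    {f g : G.edgeSet → ℝ → ℂ} (hf : ∀ e, MemH2 (ℓ e) (f e)) (hg : ∀ e, MemH2 (ℓ e) (g e))
    (e : G.edgeSet) (v : V) :
    vertexDeriv o ℓ (f + g) e v = vertexDeriv o ℓ f e v + vertexDeriv o ℓ g e v := by
  have h := derivWithin_add_eqOn ((hf e).differentiableOn (hℓ e))
    ((hg e).differentiableOn (hℓ e))
  have h0 := h (left_mem_Icc.2 (hℓ e).le)
  have h1 := h (right_mem_Icc.2 (hℓ e).le)
  unfold vertexDeriv
  simp only [Pi.add_apply] at h0 h1 ⊢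
  split_ifs
  · exact h0
  · rw [h1]; ring

theorem vertexDeriv_smul (o : Orientation G) {ℓ : G.edgeSet → ℝ} (hℓ : ∀ e, 0 < ℓ e) (c : ℂ)
    {f : G.edgeSet → ℝ → ℂ} (hf : ∀ e, MemH2 (ℓ e) (f e)) (e : G.edgeSet) (v : V) :
    vertexDeriv o ℓ (c • f) e v = c * vertexDeriv o ℓ f e v := by
  have h := derivWithin_smul_eqOn c ((hf e).differentiableOn (hℓ e))
  have h0 := h (left_mem_Icc.2 (hℓ e).le)
  have h1 := h (right_mem_Icc.2 (hℓ e).le)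
  unfold vertexDeriv
  simp only [Pi.smul_apply, smul_eq_mul] at h0 h1 ⊢
  split_ifs
  · exact h0
  · rw [h1]; ring

theorem Kirchhoff.add [G.LocallyFinite] {o : Orientation G} {ℓ : G.edgeSet → ℝ}
    (hℓ : ∀ e, 0 < ℓ e) {f g : G.edgeSet → ℝ → ℂ} (hf : ∀ e, MemH2 (ℓ e) (f e))
    (hg : ∀ e, MemH2 (ℓ e) (g e)) {v : V} (kf : Kirchhoff o ℓ f v) (kg : Kirchhoff o ℓ g v) :
    Kirchhoff o ℓ (f + g) v := by
  refine ⟨fun w w' => ?_, ?_⟩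
  · rw [vertexValue_add, vertexValue_add, kf.1 w w', kg.1 w w']
  · simp only [vertexDeriv_add o hℓ hf hg, Finset.sum_add_distrib, kf.2, kg.2, add_zero]

theorem Kirchhoff.smul [G.LocallyFinite] {o : Orientation G} {ℓ : G.edgeSet → ℝ}
    (hℓ : ∀ e, 0 < ℓ e) (c : ℂ) {f : G.edgeSet → ℝ → ℂ} (hf : ∀ e, MemH2 (ℓ e) (f e))
    {v : V} (kf : Kirchhoff o ℓ f v) : Kirchhoff o ℓ (c • f) v := by
  refine ⟨fun w w' => ?_, ?_⟩
  · rw [vertexValue_smul, vertexValue_smul, kf.1 w w']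
  · simp only [vertexDeriv_smul o hℓ c hf, ← Finset.mul_sum, kf.2, mul_zero]

theorem Kirchhoff.zero [G.LocallyFinite] (o : Orientation G) (ℓ : G.edgeSet → ℝ) (v : V) :
    Kirchhoff o ℓ 0 v := by
  refine ⟨fun w w' => ?_, ?_⟩
  · simp [vertexValue]
  · simp [vertexDeriv]

/-! ### The Kirchhoff Laplacian -/

/-- The graph of the maximal Kirchhoff Laplacian: the pairs `(u, w)` in `L²(𝒢) × L²(𝒢)` such that
`u` has a representative `f` that is in `H²` on every edge and satisfies the Kirchhoff conditions
at every vertex, and `w = -f''` on every edge. -/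
def laplacianGraph [G.LocallyFinite] (o : Orientation G) {ℓ : G.edgeSet → ℝ}
    (hℓ : ∀ e, 0 < ℓ e) : Submodule ℂ (L2 G ℓ × L2 G ℓ) where
  carrier := {p | ∃ f : G.edgeSet → ℝ → ℂ, (∀ e, MemH2 (ℓ e) (f e)) ∧
    (∀ v, Kirchhoff o ℓ f v) ∧
    (∀ e, p.1 e =ᵐ[volume.restrict (Icc 0 (ℓ e))] f e) ∧
    ∀ e, p.2 e =ᵐ[volume.restrict (Icc 0 (ℓ e))] -secondDeriv (ℓ e) (f e)}
  zero_mem' := by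
    refine ⟨0, fun e => MemH2.zero _, Kirchhoff.zero o ℓ, fun e => ?_, fun e => ?_⟩
    · exact Lp.coeFn_zero _ _ _
    · simp only [Pi.zero_apply, secondDeriv_zero, neg_zero]
      exact Lp.coeFn_zero _ _ _
  add_mem' := by
    rintro ⟨u, w⟩ ⟨u', w'⟩ ⟨f, hf, kf, h1, h2⟩ ⟨f', hf', kf', h1', h2'⟩
    refine ⟨f + f', fun e => (hf e).add (hℓ e) (hf' e), fun v => (kf v).add hℓ hf hf' (kf' v),
      fun e => ?_, fun e => ?_⟩
    · exact (Lp.coeFn_add (u e) (u' e)).trans ((h1 e).add (h1' e))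
    · refine (Lp.coeFn_add (w e) (w' e)).trans (((h2 e).add (h2' e)).trans ?_)
      filter_upwards [secondDeriv_add (hℓ e) (hf e) (hf' e)] with x hx
      simp only [Pi.add_apply, Pi.neg_apply] at hx ⊢
      rw [hx]; ring
  smul_mem' := by
    rintro c ⟨u, w⟩ ⟨f, hf, kf, h1, h2⟩
    refine ⟨c • f, fun e => (hf e).smul (hℓ e) c, fun v => (kf v).smul hℓ c hf,
      fun e => ?_, fun e => ?_⟩
    · exact (Lp.coeFn_smul c (u e)).trans ((h1 e).const_smul c)
    · refine (Lp.coeFn_smul c (w e)).trans (((h2 e).const_smul c).trans ?_)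
      filter_upwards [secondDeriv_smul (hℓ e) c (hf e)] with x hx
      simp only [Pi.smul_apply, Pi.neg_apply, smul_eq_mul] at hx ⊢
      rw [hx]; ring

/-- The maximal Kirchhoff Laplacian `H` in `L²(𝒢)`. -/
def maximalLaplacian [G.LocallyFinite] (o : Orientation G) {ℓ : G.edgeSet → ℝ}
    (hℓ : ∀ e, 0 < ℓ e) : L2 G ℓ →ₗ.[ℂ] L2 G ℓ :=
  (laplacianGraph o hℓ).toLinearPMap

/-- `laplacianGraph` is single-valued, so it is indeed the graph of `maximalLaplacian`. -/
theorem maximalLaplacian_graph [G.LocallyFinite] (o : Orientation G) {ℓ : G.edgeSet → ℝ}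
    (hℓ : ∀ e, 0 < ℓ e) : (maximalLaplacian o hℓ).graph = laplacianGraph o hℓ := by
  refine Submodule.toLinearPMap_graph_eq _ ?_
  rintro ⟨u, w⟩ ⟨f, hf, -, h1, h2⟩ (rfl : u = 0)
  refine lp.ext (funext fun e => Lp.ext ?_)
  have h0 : f e =ᵐ[volume.restrict (Icc 0 (ℓ e))] 0 :=
    (h1 e).symm.trans (Lp.coeFn_zero _ _ _)
  refine (h2 e).trans (Filter.EventuallyEq.trans ?_ (Lp.coeFn_zero _ _ _).symm)
  filter_upwards [ae_restrict_mem measurableSet_Icc] with x hx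
  simp [secondDeriv_eq_zero (hℓ e) (hf e) h0 hx]

/-- The pre-minimal Kirchhoff Laplacian `H₀⁰`, the restriction of `H` to the functions that vanish
on all but finitely many edges. -/
def preminimalLaplacian [G.LocallyFinite] (o : Orientation G) {ℓ : G.edgeSet → ℝ}
    (hℓ : ∀ e, 0 < ℓ e) : L2 G ℓ →ₗ.[ℂ] L2 G ℓ :=
  (maximalLaplacian o hℓ).domRestrict (L2c G ℓ)

/-- The minimal Kirchhoff Laplacian `H₀`, the closure of `H₀⁰` in `L²(𝒢)`. -/
def minimalLaplacian [G.LocallyFinite] (o : Orientation G) {ℓ : G.edgeSet → ℝ}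
    (hℓ : ∀ e, 0 < ℓ e) : L2 G ℓ →ₗ.[ℂ] L2 G ℓ :=
  (preminimalLaplacian o hℓ).closure

/-! ### Deficiency indices -/

/-- The deficiency subspace `ker (T* - z)`, the set of the `g` with `T* g = z g`. -/
def deficiencySubspace {H : Type*} [NormedAddCommGroup H] [InnerProductSpace ℂ H]
    [CompleteSpace H] (T : H →ₗ.[ℂ] H) (z : ℂ) : Submodule ℂ H :=
  T.adjoint.graph.comap (LinearMap.id.prod (z • LinearMap.id))

/-- `dim ker (T* - z)` as an element of `ℕ ∪ {∞}`. The deficiency indices `n₊(T)` and `n₋(T)` are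
its values at `z = i` and `z = -i`. -/
def defect {H : Type*} [NormedAddCommGroup H] [InnerProductSpace ℂ H]
    [CompleteSpace H] (T : H →ₗ.[ℂ] H) (z : ℂ) : ℕ∞ :=
  Cardinal.toENat (Module.rank ℂ (deficiencySubspace T z))

/-! ### Antitrees -/

/-- The antitree with sphere numbers `s 0 = 1, s 1, s 2, …`: the combinatorial sphere `Sₙ` consists
of the `s n` vertices `⟨n, i⟩`, and two vertices are adjacent exactly when they lie in consecutive
spheres. -/
def antitree (s : ℕ → ℕ) : SimpleGraph (Σ n, Fin (s n)) where
  Adj x y := x.1 + 1 = y.1 ∨ y.1 + 1 = x.1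
  symm := ⟨fun _ _ h => h.symm⟩
  loopless := ⟨fun x h => by omega⟩

instance (s : ℕ → ℕ) : (antitree s).LocallyFinite := fun x => by
  refine Set.Finite.fintype (Set.Finite.subset
    (((Finset.range (x.1 + 2)).sigma fun n => (Finset.univ : Finset (Fin (s n)))).finite_toSet) ?_)
  rintro ⟨m, i⟩ (h : x.1 + 1 = m ∨ m + 1 = x.1)
  simp only [Finset.mem_coe, Finset.mem_sigma, Finset.mem_range, Finset.mem_univ, and_true]
  omega

end QuantumGraph

end

/-! Write `z = -κ ^ 2`. Testing against functions supported on one edge or on one star shows that a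
deficiency subspace consists of the square integrable Kirchhoff solutions of `f'' = κ² f`
(`mem_deficiencySubspace_iff_expSol`). When no `sinSol κ (ℓ e)` vanishes, such a solution is
determined by its vertex values, and these satisfy a discrete equation with coupling `1 / S` and
diagonal entries `C / S` (`rank_deficiencySubspace_eq`). It remains to choose lengths for which the
admissible vertex functions form a space of dimension `N`.

Partition the labels `j ∈ ℕ` into `N` classes by an idempotent map `cls` with `cls i ≤ i`; the
representatives are the fixed points. An edge between the spheres `k - 1` and `k` is much shorter if
its labels share a class than if they do not. Two vertices of one sphere with labels in the same
class have equations with the same coefficients, and the diagonal coefficient is nonzero, so every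
solution is constant on classes within a sphere. The equations on sphere `n` then form a system for
the class values on sphere `n + 1`, with one equation for each class met by the labels up to `n`.
Its matrix is a small perturbation of a diagonal one, since different classes are only weakly
coupled. There is one additional unknown exactly when `n + 1` is a representative. Hence a solution
is determined by its values at the vertices `vtx j j` with `cls j = j` (`DiscreteSolution.eq_zero`),
and every bounded choice of these values occurs (`exists_discreteSolution`).

From one sphere to the next the bound on the solution grows by a factor `100`, while the lengths
decay at least like `10 ^ (-6 k)`. This outweighs both the growth and the number of edges, so the
constructed solutions are square integrable (`memℓp_interpolationLp_of_le`). The dimension is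
therefore the number of classes (`toENat_rank_solutionSpace`), for every `z` of modulus `1`. -/

noncomputable section

namespace QuantumGraph

/-! ### Absolutely continuous complex functions -/

theorem absolutelyContinuous_ofReal {f : ℝ → ℝ} {a b : ℝ}
    (hf : AbsolutelyContinuousOnInterval f a b) :
    AbsolutelyContinuousOnInterval (fun x => (f x : ℂ)) a b := by
  rw [absolutelyContinuousOnInterval_iff] at hf ⊢
  simpa only [Complex.dist_of_im_eq, Complex.ofReal_im, Complex.ofReal_re] using hf

/-- Real and imaginary parts reduce this to real integrands. The recombined function is only known
to agree with the complex integral on `uIcc a b`, which is all that absolute continuity tests. -/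
theorem absolutelyContinuous_integral {f : ℝ → ℂ} {a b c : ℝ}
    (h : IntervalIntegrable f volume a b) (hc : c ∈ uIcc a b) :
    AbsolutelyContinuousOnInterval (fun x => ∫ t in c..x, f t) a b := by
  have hre : IntervalIntegrable (fun t => (f t).re) volume a b :=
    ⟨h.1.re, h.2.re⟩
  have him : IntervalIntegrable (fun t => (f t).im) volume a b :=
    ⟨h.1.im, h.2.im⟩
  have h1 := (absolutelyContinuous_ofReal
    (hre.absolutelyContinuousOnInterval_intervalIntegral hc)).add
    ((absolutelyContinuous_ofReal
      (him.absolutelyContinuousOnInterval_intervalIntegral hc)).const_smul Complex.I)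
  rw [absolutelyContinuousOnInterval_iff] at h1 ⊢
  intro ε hε
  obtain ⟨δ, hδ, H⟩ := h1 ε hε
  refine ⟨δ, hδ, fun E hE hE' => ?_⟩
  have key : ∀ x ∈ uIcc a b, ((fun x => ((∫ t in c..x, (f t).re : ℝ) : ℂ)) +
      Complex.I • fun x => ((∫ t in c..x, (f t).im : ℝ) : ℂ)) x = ∫ t in c..x, f t := by
    intro x hx
    have hi : IntervalIntegrable f volume c x :=
      h.mono_set (uIcc_subset_uIcc hc hx)
    simp only [Pi.add_apply, Pi.smul_apply, smul_eq_mul]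
    have e1 := Complex.reCLM.intervalIntegral_comp_comm hi
    have e2 := Complex.imCLM.intervalIntegral_comp_comm hi
    simp only [Complex.reCLM_apply, Complex.imCLM_apply] at e1 e2
    rw [e1, e2, mul_comm]
    exact Complex.re_add_im _
  have := H E hE hE'
  rwa [Finset.sum_congr rfl (g := fun i => dist (∫ t in c..(E.2 i).1, f t)
    (∫ t in c..(E.2 i).2, f t))] at this
  intro i hi
  exact congrArg₂ dist (key _ (hE.1 i hi).1) (key _ (hE.1 i hi).2)

theorem ae_hasDerivAt_integral {f : ℝ → ℂ} {a b : ℝ} (h : IntervalIntegrable f volume a b) :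
    ∀ᵐ x, x ∈ uIcc a b → HasDerivAt (fun x => ∫ t in a..x, f t) (f x) x := by
  filter_upwards [h.ae_hasDerivAt_integral] with x hx hxI using hx hxI a left_mem_uIcc

/-- Subtracting the primitive of `f'` leaves an absolutely continuous function whose derivative
vanishes almost everywhere, hence a constant. -/
theorem integral_eq_sub_of_ae_hasDerivAt {f f' : ℝ → ℂ} {a b : ℝ}
    (hf : AbsolutelyContinuousOnInterval f a b)
    (hd : ∀ᵐ x, x ∈ uIcc a b → HasDerivAt f (f' x) x)
    (hi : IntervalIntegrable f' volume a b) : ∫ x in a..b, f' x = f b - f a := by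
  obtain ⟨C, hC⟩ := (hf.sub (absolutelyContinuous_integral hi left_mem_uIcc)).const_of_ae_hasDerivAt_zero
    (by
      filter_upwards [hd, ae_hasDerivAt_integral hi] with x h1 h2 hx
      have := (h1 hx).sub (h2 hx)
      rwa [sub_self] at this)
  have h1 := hC a left_mem_uIcc
  have h2 := hC b right_mem_uIcc
  simp only [Pi.sub_apply, intervalIntegral.integral_same, sub_zero] at h1 h2
  rw [h1, ← h2]; ring

theorem memLp_of_continuousOn {L : ℝ} {f : ℝ → ℂ} (hf : ContinuousOn f (Icc 0 L)) :
    MemLp f 2 (volume.restrict (Icc 0 L)) := by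
  obtain ⟨C, hC⟩ := isCompact_Icc.exists_bound_of_continuousOn hf
  exact MemLp.of_bound (hf.aestronglyMeasurable measurableSet_Icc) C
    ((ae_restrict_iff' measurableSet_Icc).2 (Filter.Eventually.of_forall hC))

theorem ae_mem_Ioo (L : ℝ) : ∀ᵐ x ∂(volume.restrict (Icc (0 : ℝ) L)), x ∈ Ioo 0 L := by
  rw [← Measure.restrict_congr_set Ioo_ae_eq_Icc]
  exact ae_restrict_mem measurableSet_Ioo

/-! ### Functions in `H²` -/

section

variable {L : ℝ} {f f₁ f₂ : ℝ → ℂ}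

theorem derivWithin_eqOn (hL : 0 < L) (h : ∀ x ∈ Icc 0 L, HasDerivWithinAt f (f₁ x) (Icc 0 L) x) :
    EqOn (derivWithin f (Icc 0 L)) f₁ (Icc 0 L) :=
  fun x hx => (h x hx).derivWithin (uniqueDiffOn_Icc hL x hx)

theorem secondDeriv_ae_eq (hL : 0 < L)
    (h : ∀ x ∈ Icc 0 L, HasDerivWithinAt f (f₁ x) (Icc 0 L) x)
    (h₂ : ∀ᵐ x, x ∈ uIcc 0 L → HasDerivAt f₁ (f₂ x) x) :
    secondDeriv L f =ᵐ[volume.restrict (Icc 0 L)] f₂ := by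
  filter_upwards [ae_restrict_of_ae h₂, ae_restrict_mem measurableSet_Icc] with x h2 hx
  rw [secondDeriv, derivWithin_congr_Icc (derivWithin_eqOn hL h) hx]
  exact (h2 (by rwa [uIcc_of_le hL.le])).hasDerivWithinAt.derivWithin (uniqueDiffOn_Icc hL x hx)

/-- Only an almost everywhere derivative of `f₁` is required, because variation of constants with an
`L²` source gives no more. -/
theorem MemH2.of_hasDeriv (hL : 0 < L)
    (h : ∀ x ∈ Icc 0 L, HasDerivWithinAt f (f₁ x) (Icc 0 L) x)
    (h₁ : AbsolutelyContinuousOnInterval f₁ 0 L)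
    (h₂ : ∀ᵐ x, x ∈ uIcc 0 L → HasDerivAt f₁ (f₂ x) x)
    (hm : MemLp f₂ 2 (volume.restrict (Icc 0 L))) : MemH2 L f := by
  have hd := derivWithin_eqOn hL h
  have hc : ContinuousOn f₁ (Icc 0 L) := by
    have := h₁.continuousOn
    rwa [uIcc_of_le hL.le] at this
  refine ⟨⟨?_, (memLp_of_continuousOn hc).ae_eq ?_⟩, absolutelyContinuous_congr hL hd.symm h₁,
    hm.ae_eq (secondDeriv_ae_eq hL h h₂).symm⟩
  · apply ContDiffOn.absolutelyContinuousOnInterval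
    rw [uIcc_of_le hL.le, contDiffOn_one_iff_derivWithin (uniqueDiffOn_Icc hL)]
    exact ⟨fun x hx => (h x hx).differentiableWithinAt, hc.congr hd⟩
  · filter_upwards [ae_restrict_mem measurableSet_Icc] with x hx using (hd hx).symm

theorem MemH2.of_contDiff (hL : 0 < L) (h : ∀ x, HasDerivAt f (f₁ x) x)
    (h₁ : ∀ x, HasDerivAt f₁ (f₂ x) x) (hc : Continuous f₂) : MemH2 L f := by
  refine MemH2.of_hasDeriv hL (fun x _ => (h x).hasDerivWithinAt) ?_
    (Filter.Eventually.of_forall fun x _ => h₁ x) (memLp_of_continuousOn hc.continuousOn)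
  apply ContDiffOn.absolutelyContinuousOnInterval
  refine ContDiff.contDiffOn (contDiff_one_iff_deriv.2 ⟨fun x => (h₁ x).differentiableAt, ?_⟩)
  rwa [funext fun x => (h₁ x).deriv]

theorem MemH2.memLp (hL : 0 < L) (hf : MemH2 L f) : MemLp f 2 (volume.restrict (Icc 0 L)) :=
  memLp_of_continuousOn (hf.differentiableOn hL).continuousOn

theorem MemH2.memLp_secondDeriv (hf : MemH2 L f) :
    MemLp (secondDeriv L f) 2 (volume.restrict (Icc 0 L)) := hf.2.2

/-- Green's formula for a function in `H²(0, L)` and a smooth function. -/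
theorem integral_green (hL : 0 < L) (hf : MemH2 L f) {g g₁ g₂ : ℝ → ℂ}
    (hg : ∀ x, HasDerivAt g (g₁ x) x) (hg₁ : ∀ x, HasDerivAt g₁ (g₂ x) x) (hc : Continuous g₂) :
    ∫ x in Icc 0 L, (g x * secondDeriv L f x - g₂ x * f x) =
      (g L * derivWithin f (Icc 0 L) L - g₁ L * f L) -
      (g 0 * derivWithin f (Icc 0 L) 0 - g₁ 0 * f 0) := by
  have hgc : Continuous g := continuous_iff_continuousAt.2 fun x => (hg x).continuousAt
  have hgc₁ : Continuous g₁ := continuous_iff_continuousAt.2 fun x => (hg₁ x).continuousAt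
  have hac : AbsolutelyContinuousOnInterval g 0 L := by
    apply ContDiffOn.absolutelyContinuousOnInterval
    refine ContDiff.contDiffOn (contDiff_one_iff_deriv.2 ⟨fun x => (hg x).differentiableAt, ?_⟩)
    rwa [funext fun x => (hg x).deriv]
  have hac₁ : AbsolutelyContinuousOnInterval g₁ 0 L := by
    apply ContDiffOn.absolutelyContinuousOnInterval
    refine ContDiff.contDiffOn (contDiff_one_iff_deriv.2 ⟨fun x => (hg₁ x).differentiableAt, ?_⟩)
    rwa [funext fun x => (hg₁ x).deriv]
  -- The Wronskian `g f' - g₁ f` is absolutely continuous, and in its derivative the terms `g₁ f'`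
  -- cancel.
  have hAC := (hac.smul hf.2.1).sub (hac₁.smul hf.1.1)
  have hfc := (hf.differentiableOn hL).continuousOn
  rw [integral_Icc_eq_integral_Ioc, ← intervalIntegral.integral_of_le hL.le]
  refine integral_eq_sub_of_ae_hasDerivAt hAC ?_ ?_
  · rw [uIcc_of_le hL.le, ← ae_restrict_iff' measurableSet_Icc]
    filter_upwards [ae_differentiableWithinAt hL hf.2.1, ae_mem_Ioo L] with x hx hxI
    have hn : Icc 0 L ∈ nhds x := Icc_mem_nhds hxI.1 hxI.2
    have h1 : HasDerivAt (derivWithin f (Icc 0 L)) (secondDeriv L f x) x :=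
      hx.hasDerivWithinAt.hasDerivAt hn
    have h0 : HasDerivAt f (derivWithin f (Icc 0 L) x) x :=
      (hf.differentiableOn hL x (Ioo_subset_Icc_self hxI)).hasDerivWithinAt.hasDerivAt hn
    convert! ((hg x).mul h1).sub ((hg₁ x).mul h0) using 1
    ring
  · have i1 : IntegrableOn (fun x => g x * secondDeriv L f x) (Icc 0 L) :=
      IntegrableOn.continuousOn_mul hgc.continuousOn (hf.2.2.integrable (by norm_num)) isCompact_Icc
    have i2 : IntegrableOn (fun x => g₂ x * f x) (Icc 0 L) :=
      (hc.continuousOn.mul hfc).integrableOn_Icc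
    rw [intervalIntegrable_iff_integrableOn_Icc_of_le hL.le]
    exact i1.sub i2

end

/-! ### The equation `-f'' = z f` on an edge -/

section

variable {L : ℝ} {κ : ℂ}

/-- The function `c.1 e^{κ x} + c.2 e^{-κ x}`. -/
def expSol (κ : ℂ) (c : ℂ × ℂ) (x : ℝ) : ℂ :=
  c.1 * Complex.exp (κ * x) + c.2 * Complex.exp (-κ * x)

theorem hasDerivAt_exp_mul (κ : ℂ) (x : ℝ) :
    HasDerivAt (fun x : ℝ => Complex.exp (κ * x)) (κ * Complex.exp (κ * x)) x := by
  have h : HasDerivAt (fun w : ℂ => Complex.exp (κ * w)) (Complex.exp (κ * x) * (κ * 1)) (x : ℂ) :=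
    ((hasDerivAt_id (x : ℂ)).const_mul κ).cexp
  convert! h.comp_ofReal using 1
  ring

theorem hasDerivAt_expSol (κ : ℂ) (c : ℂ × ℂ) (x : ℝ) :
    HasDerivAt (expSol κ c) (expSol κ (κ * c.1, -κ * c.2) x) x := by
  convert! ((hasDerivAt_exp_mul κ x).const_mul c.1).add
    ((hasDerivAt_exp_mul (-κ) x).const_mul c.2) using 1
  simp only [expSol]
  ring

theorem expSol_deriv_deriv (κ : ℂ) (c : ℂ × ℂ) (x : ℝ) :
    expSol κ (κ * (κ * c.1), -κ * (-κ * c.2)) x = κ ^ 2 * expSol κ c x := by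
  simp only [expSol]; ring

theorem hasDerivAt_expSol_deriv (κ : ℂ) (c : ℂ × ℂ) (x : ℝ) :
    HasDerivAt (expSol κ (κ * c.1, -κ * c.2)) (κ ^ 2 * expSol κ c x) x := by
  have := hasDerivAt_expSol κ (κ * c.1, -κ * c.2) x
  rwa [expSol_deriv_deriv] at this

theorem continuous_expSol (κ : ℂ) (c : ℂ × ℂ) : Continuous (expSol κ c) :=
  continuous_iff_continuousAt.2 fun x => (hasDerivAt_expSol κ c x).continuousAt

theorem derivWithin_expSol (hL : 0 < L) (κ : ℂ) (c : ℂ × ℂ) :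
    EqOn (derivWithin (expSol κ c) (Icc 0 L)) (expSol κ (κ * c.1, -κ * c.2)) (Icc 0 L) :=
  derivWithin_eqOn hL fun x _ => (hasDerivAt_expSol κ c x).hasDerivWithinAt

/-- Solution of the inhomogeneous equation by variation of constants. -/
theorem exists_memH2_of_integral_exp_eq_zero (hL : 0 < L) (hκ : κ ≠ 0) {q : ℝ → ℂ}
    (hq : MemLp q 2 (volume.restrict (Icc 0 L)))
    (h₁ : ∫ t in Icc 0 L, Complex.exp (κ * t) * q t = 0)
    (h₂ : ∫ t in Icc 0 L, Complex.exp (-κ * t) * q t = 0) :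
    ∃ f : ℝ → ℂ, MemH2 L f ∧ f 0 = 0 ∧ f L = 0 ∧ derivWithin f (Icc 0 L) 0 = 0 ∧
      derivWithin f (Icc 0 L) L = 0 ∧
      secondDeriv L f =ᵐ[volume.restrict (Icc 0 L)] fun x => κ ^ 2 * f x + q x := by
  have hexp : ∀ κ : ℂ, Continuous fun x : ℝ => Complex.exp (κ * x) := fun κ => by fun_prop
  have hac : ∀ κ : ℂ, AbsolutelyContinuousOnInterval (fun x : ℝ => Complex.exp (κ * x)) 0 L := by
    intro κ
    apply ContDiffOn.absolutelyContinuousOnInterval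
    refine ContDiff.contDiffOn (contDiff_one_iff_deriv.2
      ⟨fun x => (hasDerivAt_exp_mul κ x).differentiableAt, ?_⟩)
    rw [funext fun x => (hasDerivAt_exp_mul κ x).deriv]
    exact continuous_const.mul (hexp κ)
  have hint : ∀ κ : ℂ, IntervalIntegrable (fun t : ℝ => Complex.exp (κ * t) * q t) volume 0 L := by
    intro κ
    rw [intervalIntegrable_iff_integrableOn_Icc_of_le hL.le]
    exact IntegrableOn.continuousOn_mul (hexp κ).continuousOn (hq.integrable (by norm_num))
      isCompact_Icc
  rw [integral_Icc_eq_integral_Ioc, ← intervalIntegral.integral_of_le hL.le] at h₁ h₂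
  -- The two primitives vanish at `0` by definition and at `L` by the orthogonality hypotheses, so
  -- the Cauchy data of `f` vanish at both ends.
  set A : ℝ → ℂ := fun x => ∫ t in (0 : ℝ)..x, Complex.exp (-κ * t) * q t with hA
  set B : ℝ → ℂ := fun x => ∫ t in (0 : ℝ)..x, Complex.exp (κ * t) * q t with hB
  have A0 : A 0 = 0 := intervalIntegral.integral_same
  have B0 : B 0 = 0 := intervalIntegral.integral_same
  have AL : A L = 0 := h₂
  have BL : B L = 0 := h₁
  have hAac : AbsolutelyContinuousOnInterval A 0 L :=
    absolutelyContinuous_integral (hint (-κ)) left_mem_uIcc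
  have hBac : AbsolutelyContinuousOnInterval B 0 L :=
    absolutelyContinuous_integral (hint κ) left_mem_uIcc
  set f : ℝ → ℂ := fun x => (2 * κ)⁻¹ * (Complex.exp (κ * x) * A x - Complex.exp (-κ * x) * B x)
    with hf
  set f₁ : ℝ → ℂ := fun x => 2⁻¹ * (Complex.exp (κ * x) * A x + Complex.exp (-κ * x) * B x) with hf₁
  have hfac : AbsolutelyContinuousOnInterval f 0 L :=
    (((hac κ).smul hAac).sub ((hac (-κ)).smul hBac)).const_smul (2 * κ)⁻¹
  have hf₁ac : AbsolutelyContinuousOnInterval f₁ 0 L :=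
    (((hac κ).smul hAac).add ((hac (-κ)).smul hBac)).const_smul (2⁻¹ : ℂ)
  have hf₁c : ContinuousOn f₁ (Icc 0 L) := by
    have := hf₁ac.continuousOn
    rwa [uIcc_of_le hL.le] at this
  have hd : ∀ᵐ x, x ∈ uIcc 0 L → HasDerivAt f (f₁ x) x ∧
      HasDerivAt f₁ (κ ^ 2 * f x + q x) x := by
    filter_upwards [ae_hasDerivAt_integral (hint (-κ)), ae_hasDerivAt_integral (hint κ)]
      with x hx₁ hx₂ hx
    have d1 := (hasDerivAt_exp_mul κ x).mul (hx₁ hx)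
    have d2 := (hasDerivAt_exp_mul (-κ) x).mul (hx₂ hx)
    have e : Complex.exp (κ * x) * Complex.exp (-(κ * x)) = 1 := by
      rw [← Complex.exp_add]; simp
    refine ⟨?_, ?_⟩
    · convert! (d1.sub d2).const_mul ((2 * κ)⁻¹) using 1
      simp only [hf₁, hA, hB]
      field_simp
      ring
    · convert! (d1.add d2).const_mul (2⁻¹ : ℂ) using 1
      simp only [hf, hA, hB, neg_mul]
      field_simp
      linear_combination (-2 * q x) * e
  have hf0 : f 0 = 0 := by simp [hf, A0, B0]
  -- The derivative of `f` is known only almost everywhere so far. Since `f` is the integral of the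
  -- continuous `f₁`, it is differentiable at every point.
  have hderiv : ∀ x ∈ Icc 0 L, HasDerivWithinAt f (f₁ x) (Icc 0 L) x := by
    have hG : ∀ x ∈ Icc (0 : ℝ) L, ∫ t in (0 : ℝ)..x, f₁ t = f x := by
      intro x hx
      have hsub : uIcc 0 x ⊆ uIcc 0 L := uIcc_subset_uIcc left_mem_uIcc (by rwa [uIcc_of_le hL.le])
      rw [integral_eq_sub_of_ae_hasDerivAt (hfac.mono hsub), hf0, sub_zero]
      · filter_upwards [hd] with y hy hyx using (hy (hsub hyx)).1
      · refine (hf₁c.mono ?_).intervalIntegrable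
        rwa [uIcc_of_le hL.le] at hsub
    intro x hx
    refine HasDerivWithinAt.congr (f := fun y => ∫ t in (0 : ℝ)..y, f₁ t) ?_
      (fun y hy => (hG y hy).symm) (hG x hx).symm
    have : Fact (x ∈ Icc (0 : ℝ) L) := ⟨hx⟩
    refine intervalIntegral.integral_hasDerivWithinAt_right ?_ ?_ (hf₁c x hx)
    · refine (hf₁c.mono ?_).intervalIntegrable
      rw [uIcc_of_le hx.1]
      exact Icc_subset_Icc_right hx.2
    · exact hf₁c.stronglyMeasurableAtFilter_nhdsWithin measurableSet_Icc x
  have hd2 : ∀ᵐ x, x ∈ uIcc 0 L → HasDerivAt f₁ (κ ^ 2 * f x + q x) x := by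
    filter_upwards [hd] with x hx hxI using (hx hxI).2
  have hfc : ContinuousOn f (Icc 0 L) := fun x hx => (hderiv x hx).continuousWithinAt
  have hdw := derivWithin_eqOn hL hderiv
  refine ⟨f, MemH2.of_hasDeriv hL hderiv hf₁ac hd2
    ((memLp_of_continuousOn (continuousOn_const.mul hfc)).add hq), hf0, ?_, ?_, ?_,
    secondDeriv_ae_eq hL hderiv hd2⟩
  · simp [hf, AL, BL]
  · rw [hdw (left_mem_Icc.2 hL.le)]
    simp [hf₁, A0, B0]
  · rw [hdw (right_mem_Icc.2 hL.le)]
    simp [hf₁, AL, BL]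

/-- A function that is orthogonal to `f'' + z̄ f` for all `f ∈ H²₀(0, L)` solves `-g'' = z g`. -/
theorem exists_expSol_ae_eq (hL : 0 < L) (hκ : κ ≠ 0) (g : Lp ℂ 2 (volume.restrict (Icc 0 L)))
    (h : ∀ f : ℝ → ℂ, MemH2 L f → f 0 = 0 → f L = 0 → derivWithin f (Icc 0 L) 0 = 0 →
      derivWithin f (Icc 0 L) L = 0 →
      ∫ x in Icc 0 L, (starRingEnd ℂ) (g x) *
        (secondDeriv L f x - (starRingEnd ℂ) (κ ^ 2) * f x) = 0) :
    ∃ c : ℂ × ℂ, g =ᵐ[volume.restrict (Icc 0 L)] expSol κ c := by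
  have hexp : ∀ κ : ℂ, MemLp (fun x : ℝ => Complex.exp (κ * x)) 2 (volume.restrict (Icc 0 L)) :=
    fun κ => memLp_of_continuousOn (by fun_prop)
  set E : ℂ → Lp ℂ 2 (volume.restrict (Icc 0 L)) := fun κ => (hexp κ).toLp with hE
  set K : Submodule ℂ (Lp ℂ 2 (volume.restrict (Icc 0 L))) := Submodule.span ℂ {E κ, E (-κ)}
  have hK : FiniteDimensional ℂ K := FiniteDimensional.span_of_finite ℂ (by simp)
  -- Every `q ⊥ K` has the form `f'' - conj (κ²) f` with vanishing Cauchy data, so `g` is orthogonal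
  -- to `Kᗮ`. As `K` is finite dimensional, `Kᗮᗮ = K`.
  have hgK : g ∈ K := by
    rw [← Submodule.orthogonal_orthogonal K, Submodule.mem_orthogonal]
    intro q hq
    have hqe : ∀ w : ℂ, E w ∈ K →
        ∫ t in Icc 0 L, Complex.exp ((starRingEnd ℂ) w * t) * q t = 0 := by
      intro w hw
      have := hq (E w) hw
      rw [L2.inner_def] at this
      rw [← this]
      refine integral_congr_ae ?_
      filter_upwards [(hexp w).coeFn_toLp] with x hx
      rw [RCLike.inner_apply, hx, ← Complex.exp_conj, map_mul, Complex.conj_ofReal, mul_comm]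
    obtain ⟨f, hf, f0, fL, f0', fL', hfq⟩ := exists_memH2_of_integral_exp_eq_zero hL
      (κ := (starRingEnd ℂ) κ) (by simpa using hκ) (Lp.memLp q)
      (hqe _ (Submodule.subset_span (by simp)))
      (by rw [← map_neg]; exact hqe _ (Submodule.subset_span (by simp)))
    rw [← inner_conj_symm, L2.inner_def]
    rw [show ∫ a in Icc 0 L, inner ℂ (g a) (q a) = 0 from ?_, map_zero]
    rw [← h f hf f0 fL f0' fL']
    refine integral_congr_ae ?_
    filter_upwards [hfq] with x hx
    rw [RCLike.inner_apply, hx, map_pow, mul_comm]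
    ring
  obtain ⟨a, b, hab⟩ := Submodule.mem_span_pair.1 hgK
  refine ⟨(a, b), ?_⟩
  rw [← hab]
  filter_upwards [Lp.coeFn_add (a • E κ) (b • E (-κ)), Lp.coeFn_smul a (E κ),
    Lp.coeFn_smul b (E (-κ)), (hexp κ).coeFn_toLp, (hexp (-κ)).coeFn_toLp] with x h1 h2 h3 h4 h5
  rw [h1, Pi.add_apply, h2, h3, Pi.smul_apply, Pi.smul_apply, h4, h5]
  simp [expSol]

end

section

/-! ### The deficiency subspaces of the minimal Laplacian -/

/-- The adjoint relation is a closed condition on pairs in the graph, so it passes from the graph of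
`T` to its closure. -/
theorem mem_deficiencySubspace_closure_iff {H : Type*} [NormedAddCommGroup H]
    [InnerProductSpace ℂ H] [CompleteSpace H] {T : H →ₗ.[ℂ] H} (hT : Dense (T.domain : Set H))
    (z : ℂ) (u : H) :
    u ∈ deficiencySubspace T.closure z ↔
      ∀ p ∈ T.graph, inner ℂ (z • u) p.1 = inner ℂ u p.2 := by
  have hT' : Dense (T.closure.domain : Set H) := hT.mono T.le_closure.1
  have h1 : u ∈ deficiencySubspace T.closure z ↔
      ∀ p ∈ T.closure.graph, inner ℂ (z • u) p.1 = inner ℂ u p.2 := by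
    rw [deficiencySubspace, Submodule.mem_comap, LinearPMap.adjoint_graph_eq_graph_adjoint hT',
      Submodule.mem_adjoint_iff]
    constructor
    · rintro h ⟨a, b⟩ hp
      have := h a b hp
      simp only [LinearMap.prod_apply] at this
      have := congrArg (starRingEnd ℂ) this
      simp only [map_sub, inner_conj_symm, map_zero, sub_eq_zero] at this
      exact this.symm
    · intro h a b hp
      have := congrArg (starRingEnd ℂ) (h (a, b) hp)
      simp only [inner_conj_symm] at this
      simp [this]
  rw [h1]
  refine ⟨fun h p hp => h p (LinearPMap.le_graph_of_le T.le_closure hp), fun h => ?_⟩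
  -- No closability has to be proved: for a non-closable `T` the closure is `T` by convention.
  by_cases hc : T.IsClosable
  · rw [← hc.graph_closure_eq_closure_graph]
    intro p hp
    have hcl : IsClosed {p : H × H | inner ℂ (z • u) p.1 = inner ℂ u p.2} :=
      isClosed_eq (by fun_prop) (by fun_prop)
    exact closure_minimal (s := (T.graph : Set (H × H))) h hcl hp
  · rwa [LinearPMap.closure_def' hc]

variable {V : Type*} {G : SimpleGraph V} {ℓ : G.edgeSet → ℝ}

theorem mem_graph_preminimalLaplacian_iff [G.LocallyFinite] (o : Orientation G)
    (hℓ : ∀ e, 0 < ℓ e) (p : L2 G ℓ × L2 G ℓ) :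
    p ∈ (preminimalLaplacian o hℓ).graph ↔ p ∈ laplacianGraph o hℓ ∧ p.1 ∈ L2c G ℓ := by
  rw [← maximalLaplacian_graph, LinearPMap.mem_graph_iff', LinearPMap.mem_graph_iff']
  constructor
  · rintro ⟨⟨y, hy⟩, rfl⟩
    exact ⟨⟨⟨y, hy.2⟩, rfl⟩, hy.1⟩
  · rintro ⟨⟨y, rfl⟩, h⟩
    exact ⟨⟨y, h, y.2⟩, rfl⟩

theorem Kirchhoff.of_eq_zero [G.LocallyFinite] {o : Orientation G} {f : G.edgeSet → ℝ → ℂ}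
    (h₀ : ∀ e, f e 0 = 0) (h₁ : ∀ e, f e (ℓ e) = 0)
    (h₂ : ∀ e, derivWithin (f e) (Icc 0 (ℓ e)) 0 = 0)
    (h₃ : ∀ e, derivWithin (f e) (Icc 0 (ℓ e)) (ℓ e) = 0) (v : V) : Kirchhoff o ℓ f v := by
  simp [Kirchhoff, vertexValue, vertexDeriv, h₀, h₁, h₂, h₃]

theorem Kirchhoff.congr [G.LocallyFinite] {o : Orientation G} (hℓ : ∀ e, 0 < ℓ e)
    {f g : G.edgeSet → ℝ → ℂ} (h : ∀ e, EqOn (f e) (g e) (Icc 0 (ℓ e))) {v : V}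
    (hf : Kirchhoff o ℓ f v) : Kirchhoff o ℓ g v := by
  have h0 : ∀ e, g e 0 = f e 0 := fun e => (h e (left_mem_Icc.2 (hℓ e).le)).symm
  have h1 : ∀ e, g e (ℓ e) = f e (ℓ e) := fun e => (h e (right_mem_Icc.2 (hℓ e).le)).symm
  have h2 : ∀ e, derivWithin (g e) (Icc 0 (ℓ e)) 0 = derivWithin (f e) (Icc 0 (ℓ e)) 0 :=
    fun e => (derivWithin_congr_Icc (h e) (left_mem_Icc.2 (hℓ e).le)).symm
  have h3 : ∀ e, derivWithin (g e) (Icc 0 (ℓ e)) (ℓ e) = derivWithin (f e) (Icc 0 (ℓ e)) (ℓ e) :=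
    fun e => (derivWithin_congr_Icc (h e) (right_mem_Icc.2 (hℓ e).le)).symm
  simpa only [Kirchhoff, vertexValue, vertexDeriv, h0, h1, h2, h3] using hf

/-- Finite support makes the edgewise classes of `f` and `-f''` square summable, so concrete test
functions yield graph elements. -/
theorem exists_mem_graph_preminimalLaplacian [G.LocallyFinite] (o : Orientation G)
    (hℓ : ∀ e, 0 < ℓ e) {f : G.edgeSet → ℝ → ℂ} (hf : ∀ e, MemH2 (ℓ e) (f e))
    (kf : ∀ v, Kirchhoff o ℓ f v) {E : Finset G.edgeSet} (hE : ∀ e ∉ E, f e = 0) :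
    ∃ p ∈ (preminimalLaplacian o hℓ).graph,
      (∀ e, p.1 e =ᵐ[volume.restrict (Icc 0 (ℓ e))] f e) ∧
      (∀ e, p.2 e =ᵐ[volume.restrict (Icc 0 (ℓ e))] -secondDeriv (ℓ e) (f e)) ∧
      ∀ e ∉ E, p.1 e = 0 ∧ p.2 e = 0 := by
  have hu : ∀ e ∉ E, ((hf e).memLp (hℓ e)).toLp (f e) = 0 := by
    intro e he
    refine Lp.ext ((MemLp.coeFn_toLp _).trans ?_)
    rw [hE e he]
    exact (Lp.coeFn_zero _ _ _).symm
  have hw : ∀ e ∉ E, ((hf e).memLp_secondDeriv.neg).toLp (-secondDeriv (ℓ e) (f e)) = 0 := by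
    intro e he
    refine Lp.ext ((MemLp.coeFn_toLp _).trans ?_)
    rw [hE e he, secondDeriv_zero, neg_zero]
    exact (Lp.coeFn_zero _ _ _).symm
  have hfin : ∀ {u : ∀ e : G.edgeSet, Lp ℂ 2 (volume.restrict (Icc 0 (ℓ e)))},
      (∀ e ∉ E, u e = 0) → {e | u e ≠ 0}.Finite := by
    intro u hu
    refine E.finite_toSet.subset fun e he => ?_
    by_contra h
    exact he (hu e h)
  set u : L2 G ℓ := ⟨fun e => ((hf e).memLp (hℓ e)).toLp (f e),
    (memℓp_zero (hfin hu)).of_exponent_ge (by norm_num)⟩ with hu_def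
  set w : L2 G ℓ := ⟨fun e => ((hf e).memLp_secondDeriv.neg).toLp (-secondDeriv (ℓ e) (f e)),
    (memℓp_zero (hfin hw)).of_exponent_ge (by norm_num)⟩ with hw_def
  have h1 : ∀ e, u e =ᵐ[volume.restrict (Icc 0 (ℓ e))] f e := fun e =>
    MemLp.coeFn_toLp ((hf e).memLp (hℓ e))
  have h2 : ∀ e, w e =ᵐ[volume.restrict (Icc 0 (ℓ e))] -secondDeriv (ℓ e) (f e) :=
    fun e => MemLp.coeFn_toLp (hf e).memLp_secondDeriv.neg
  exact ⟨(u, w), (mem_graph_preminimalLaplacian_iff o hℓ _).2 ⟨⟨f, hf, kf, h1, h2⟩, hfin hu⟩,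
    h1, h2, fun e he => ⟨hu e he, hw e he⟩⟩

/-- Smooth functions compactly supported inside a single open edge satisfy all Kirchhoff conditions
trivially. An element orthogonal to all of them vanishes almost everywhere on that edge. -/
theorem dense_domain_preminimalLaplacian [G.LocallyFinite] (o : Orientation G)
    (hℓ : ∀ e, 0 < ℓ e) : Dense ((preminimalLaplacian o hℓ).domain : Set (L2 G ℓ)) := by
  classical
  rw [Submodule.dense_iff_topologicalClosure_eq_top, Submodule.topologicalClosure_eq_top_iff,
    Submodule.eq_bot_iff]
  intro u hu
  refine lp.ext (funext fun e => Lp.ext ?_)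
  refine Filter.EventuallyEq.trans ?_ (Lp.coeFn_zero _ _ _).symm
  have hint : IntegrableOn (u e) (Icc 0 (ℓ e)) := (Lp.memLp (u e)).integrable (by norm_num)
  have key : ∀ᵐ x : ℝ, x ∈ Ioo 0 (ℓ e) → u e x = 0 := by
    refine isOpen_Ioo.ae_eq_zero_of_integral_contDiff_smul_eq_zero
      (hint.mono_set Ioo_subset_Icc_self).locallyIntegrableOn ?_
    intro φ hφ _ hs
    have hφ0 : ∀ x ∉ Ioo 0 (ℓ e), φ x = 0 := fun x hx =>
      image_eq_zero_of_notMem_tsupport fun h => hx (hs h)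
    have hφ1 : ∀ x ∉ Ioo 0 (ℓ e), deriv φ x = 0 := fun x hx =>
      image_eq_zero_of_notMem_tsupport fun h => hx (hs (tsupport_deriv_subset (𝕜 := ℝ) h))
    have hd0 : ∀ x, HasDerivAt (fun x => (φ x : ℂ)) (deriv φ x : ℝ) x := fun x =>
      ((hφ.differentiable (by simp)) x).hasDerivAt.ofReal_comp
    have hφ' : ContDiff ℝ 1 (deriv φ) := by
      exact_mod_cast contDiff_infty.1 (contDiff_infty_iff_deriv.1 hφ).2 1
    have hd1 : ∀ x, HasDerivAt (fun x => ((deriv φ x : ℝ) : ℂ)) (deriv (deriv φ) x : ℝ) x :=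
      fun x => ((hφ'.differentiable (by simp)) x).hasDerivAt.ofReal_comp
    have hH2 : MemH2 (ℓ e) (fun x => (φ x : ℂ)) := MemH2.of_contDiff (hℓ e) hd0 hd1
      (Complex.continuous_ofReal.comp (hφ'.continuous_deriv le_rfl))
    have hdw := derivWithin_eqOn (hℓ e) fun x _ => (hd0 x).hasDerivWithinAt
    set f : G.edgeSet → ℝ → ℂ := Pi.single e fun x => (φ x : ℂ) with hf
    have hne : ∀ e' ≠ e, f e' = 0 := fun e' h => Pi.single_eq_of_ne h _
    have heq : f e = fun x => (φ x : ℂ) := Pi.single_eq_same _ _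
    have hfH : ∀ e', MemH2 (ℓ e') (f e') := by
      intro e'
      by_cases h : e' = e
      · subst h; rw [heq]; exact hH2
      · rw [hne e' h]; exact MemH2.zero _
    have hk : ∀ v, Kirchhoff o ℓ f v := by
      refine Kirchhoff.of_eq_zero ?_ ?_ ?_ ?_ <;> intro e' <;> by_cases h : e' = e
      · subst h; simp [heq, hφ0]
      · simp [hne e' h]
      · subst h; simp [heq, hφ0]
      · simp [hne e' h]
      · subst h; rw [heq, hdw (left_mem_Icc.2 (hℓ _).le)]; simp [hφ1]
      · simp [hne e' h]
      · subst h; rw [heq, hdw (right_mem_Icc.2 (hℓ _).le)]; simp [hφ1]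
      · simp [hne e' h]
    obtain ⟨p, hp, hp1, -, hp0⟩ := exists_mem_graph_preminimalLaplacian o hℓ hfH hk
      (E := {e}) (fun e' h => hne e' (by simpa using h))
    have hz := hu p.1 (LinearPMap.mem_domain_of_mem_graph (y := p.2) hp)
    rw [lp.inner_eq_tsum, tsum_eq_single e (fun e' h => by
      rw [(hp0 e' (by simpa using h)).1, inner_zero_left]), L2.inner_def] at hz
    have h2 : ∫ x in Icc 0 (ℓ e), φ x • u e x = 0 := by
      rw [← hz]
      refine integral_congr_ae ?_
      filter_upwards [hp1 e] with x hx
      rw [hx, heq, RCLike.inner_apply, Complex.conj_ofReal, mul_comm, Complex.real_smul]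
    rw [← h2, setIntegral_eq_integral_of_forall_compl_eq_zero]
    intro x hx
    rw [hφ0 x fun h => hx (Ioo_subset_Icc_self h), zero_smul]
  filter_upwards [ae_restrict_of_ae key, ae_mem_Ioo (ℓ e)] with x h1 h2 using h1 h2

/-- Membership in a deficiency subspace in terms of compactly supported test functions. -/
theorem mem_deficiencySubspace_minimalLaplacian_iff [G.LocallyFinite] (o : Orientation G)
    (hℓ : ∀ e, 0 < ℓ e) (z : ℂ) (u : L2 G ℓ) :
    u ∈ deficiencySubspace (minimalLaplacian o hℓ) z ↔
      ∀ (f : G.edgeSet → ℝ → ℂ) (E : Finset G.edgeSet), (∀ e, MemH2 (ℓ e) (f e)) →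
        (∀ v, Kirchhoff o ℓ f v) → (∀ e ∉ E, f e = 0) →
        ∑ e ∈ E, ∫ x in Icc 0 (ℓ e), (starRingEnd ℂ) (u e x) *
          (secondDeriv (ℓ e) (f e) x + (starRingEnd ℂ) z * f e x) = 0 := by
  classical
  rw [minimalLaplacian, mem_deficiencySubspace_closure_iff (dense_domain_preminimalLaplacian o hℓ)]
  have key : ∀ (p : L2 G ℓ × L2 G ℓ) (f : G.edgeSet → ℝ → ℂ) (E : Finset G.edgeSet),
      (∀ e, MemH2 (ℓ e) (f e)) →
      (∀ e, p.1 e =ᵐ[volume.restrict (Icc 0 (ℓ e))] f e) →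
      (∀ e, p.2 e =ᵐ[volume.restrict (Icc 0 (ℓ e))] -secondDeriv (ℓ e) (f e)) →
      (∀ e ∉ E, p.1 e = 0 ∧ p.2 e = 0) →
      inner ℂ (z • u) p.1 - inner ℂ u p.2 =
        ∑ e ∈ E, ∫ x in Icc 0 (ℓ e), (starRingEnd ℂ) (u e x) *
          (secondDeriv (ℓ e) (f e) x + (starRingEnd ℂ) z * f e x) := by
    intro p f E hf h1 h2 h0
    rw [lp.inner_eq_tsum, lp.inner_eq_tsum,
      tsum_eq_sum (s := E) (fun e he => by rw [(h0 e he).1, inner_zero_right]),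
      tsum_eq_sum (s := E) (fun e he => by rw [(h0 e he).2, inner_zero_right]),
      ← Finset.sum_sub_distrib]
    refine Finset.sum_congr rfl fun e _ => ?_
    rw [L2.inner_def, L2.inner_def, ← integral_sub (L2.integrable_inner _ _)
      (L2.integrable_inner _ _)]
    refine integral_congr_ae ?_
    filter_upwards [h1 e, h2 e, Lp.coeFn_smul z (u e)] with x e1 e2 e3
    have e3' : (z • u) e x = z * u e x := e3
    rw [RCLike.inner_apply, RCLike.inner_apply, e1, e2, e3', map_mul, Pi.neg_apply]
    ring
  constructor
  · intro h f E hf kf hE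
    obtain ⟨p, hp, hp1, hp2, hp0⟩ := exists_mem_graph_preminimalLaplacian o hℓ hf kf hE
    rw [← key p f E hf hp1 hp2 hp0, h p hp, sub_self]
  · intro h p hp
    obtain ⟨⟨f, hf, kf, h1, h2⟩, hc⟩ := (mem_graph_preminimalLaplacian_iff o hℓ p).1 hp
    set E : Finset G.edgeSet := (show {e | p.1 e ≠ 0}.Finite from hc).toFinset with hE
    have hE0 : ∀ e ∉ E, p.1 e = 0 := fun e he => by simpa [hE] using he
    have hf0 : ∀ e ∉ E, f e =ᵐ[volume.restrict (Icc 0 (ℓ e))] 0 := fun e he => by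
      refine (h1 e).symm.trans ?_
      rw [hE0 e he]
      exact Lp.coeFn_zero _ _ _
    have hp2 : ∀ e ∉ E, p.2 e = 0 := fun e he => by
      refine Lp.ext ((h2 e).trans (Filter.EventuallyEq.trans ?_ (Lp.coeFn_zero _ _ _).symm))
      filter_upwards [ae_restrict_mem measurableSet_Icc] with x hx
      simp [secondDeriv_eq_zero (hℓ e) (hf e) (hf0 e he) hx]
    have heq : ∀ e ∉ E, EqOn (f e) 0 (Icc 0 (ℓ e)) := fun e he =>
      Measure.eqOn_Icc_of_ae_eq volume (hℓ e).ne (hf0 e he)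
        ((hf e).differentiableOn (hℓ e)).continuousOn continuousOn_const
    -- Off `E` the representative vanishes on the edge but may be nonzero outside `[0, ℓ e]`; the
    -- test condition asks for the zero function there.
    set f' : G.edgeSet → ℝ → ℂ := fun e => if e ∈ E then f e else 0 with hf'
    have hff : ∀ e, EqOn (f e) (f' e) (Icc 0 (ℓ e)) := by
      intro e
      by_cases he : e ∈ E
      · simp [hf', he, eqOn_refl]
      · simpa [hf', he] using heq e he
    have hf'H : ∀ e, MemH2 (ℓ e) (f' e) := by
      intro e
      by_cases he : e ∈ E
      · simpa [hf', he] using hf e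
      · simpa [hf', he] using MemH2.zero _
    have := h f' E hf'H (fun v => (kf v).congr hℓ hff) fun e he => by simp [hf', he]
    rw [← sub_eq_zero, key p f E hf h1 h2 fun e he => ⟨hE0 e he, hp2 e he⟩, ← this]
    refine Finset.sum_congr rfl fun e he => ?_
    simp [hf', he]

end

section

variable {V : Type*} {G : SimpleGraph V} {ℓ : G.edgeSet → ℝ}

/-! ### Green's formula on a metric graph -/

theorem Orientation.mem_iff (o : Orientation G) (e : G.edgeSet) (v : V) :
    v ∈ e.1 ↔ v = o.tail e ∨ v = o.head e := by
  rw [← o.mk_eq e, Sym2.mem_iff]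

theorem Orientation.adj (o : Orientation G) (e : G.edgeSet) : G.Adj (o.tail e) (o.head e) := by
  rw [← SimpleGraph.mem_edgeSet, o.mk_eq]
  exact e.2

theorem Orientation.head_ne_tail (o : Orientation G) (e : G.edgeSet) : o.head e ≠ o.tail e :=
  (o.adj e).ne'

theorem starEdge_injective (v : V) : Function.Injective (starEdge (G := G) v) := by
  intro w w' h
  have := congrArg Subtype.val h
  simp only [starEdge, Sym2.congr_right] at this
  exact Subtype.ext this

theorem mem_starEdge (v : V) (w : G.neighborSet v) : v ∈ (starEdge v w).1 :=
  Sym2.mem_mk_left _ _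

theorem exists_starEdge_eq {e : G.edgeSet} {v : V} (h : v ∈ e.1) : ∃ w, starEdge v w = e := by
  obtain ⟨w, hw⟩ := Sym2.mem_iff_exists.1 h
  refine ⟨⟨w, ?_⟩, Subtype.ext hw.symm⟩
  have := e.2
  rwa [hw] at this

theorem vertexValue_tail (o : Orientation G) (f : G.edgeSet → ℝ → ℂ) (e : G.edgeSet) :
    vertexValue o ℓ f e (o.tail e) = f e 0 := if_pos rfl

theorem vertexValue_head (o : Orientation G) (f : G.edgeSet → ℝ → ℂ) (e : G.edgeSet) :
    vertexValue o ℓ f e (o.head e) = f e (ℓ e) := if_neg (o.head_ne_tail e)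

theorem vertexDeriv_tail (o : Orientation G) (f : G.edgeSet → ℝ → ℂ) (e : G.edgeSet) :
    vertexDeriv o ℓ f e (o.tail e) = derivWithin (f e) (Icc 0 (ℓ e)) 0 := if_pos rfl

theorem vertexDeriv_head (o : Orientation G) (f : G.edgeSet → ℝ → ℂ) (e : G.edgeSet) :
    vertexDeriv o ℓ f e (o.head e) = -derivWithin (f e) (Icc 0 (ℓ e)) (ℓ e) :=
  if_neg (o.head_ne_tail e)

theorem vertexValue_of_eq_zero (o : Orientation G) {f : G.edgeSet → ℝ → ℂ} {e : G.edgeSet}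
    (h : f e = 0) (v : V) : vertexValue o ℓ f e v = 0 := by
  simp [vertexValue, h]

theorem vertexDeriv_of_eq_zero (o : Orientation G) {f : G.edgeSet → ℝ → ℂ} {e : G.edgeSet}
    (h : f e = 0) (v : V) : vertexDeriv o ℓ f e v = 0 := by
  simp [vertexDeriv, h]

/-- The contribution of the endpoint `v` of the edge `e` to the boundary terms in Green's
formula. -/
def boundaryForm (o : Orientation G) (ℓ : G.edgeSet → ℝ) (g f : G.edgeSet → ℝ → ℂ)
    (e : G.edgeSet) (v : V) : ℂ :=
  (starRingEnd ℂ) (vertexDeriv o ℓ g e v) * vertexValue o ℓ f e v -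
    (starRingEnd ℂ) (vertexValue o ℓ g e v) * vertexDeriv o ℓ f e v

theorem conj_expSol (κ : ℂ) (c : ℂ × ℂ) (x : ℝ) :
    (starRingEnd ℂ) (expSol κ c x) =
      expSol ((starRingEnd ℂ) κ) ((starRingEnd ℂ) c.1, (starRingEnd ℂ) c.2) x := by
  simp [expSol, ← Complex.exp_conj]

/-- Green's formula applies to the conjugate solution, which has parameter `conj κ`. The sign in the
derivative at the head turns the difference of boundary terms into a sum. -/
theorem integral_expSol_green (o : Orientation G) (hℓ : ∀ e, 0 < ℓ e) (κ : ℂ)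
    (c : G.edgeSet → ℂ × ℂ) {f : G.edgeSet → ℝ → ℂ} {e : G.edgeSet} (hf : MemH2 (ℓ e) (f e)) :
    ∫ x in Icc 0 (ℓ e), (starRingEnd ℂ) (expSol κ (c e) x) *
        (secondDeriv (ℓ e) (f e) x + (starRingEnd ℂ) (-κ ^ 2) * f e x) =
      boundaryForm o ℓ (fun e => expSol κ (c e)) f e (o.tail e) +
        boundaryForm o ℓ (fun e => expSol κ (c e)) f e (o.head e) := by
  have hd := derivWithin_expSol (hℓ e) κ (c e)
  have h := integral_green (hℓ e) hf
    (hasDerivAt_expSol ((starRingEnd ℂ) κ) ((starRingEnd ℂ) (c e).1, (starRingEnd ℂ) (c e).2))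
    (hasDerivAt_expSol_deriv _ _) (continuous_const.mul (continuous_expSol _ _))
  simp only [boundaryForm, vertexValue_tail, vertexValue_head, vertexDeriv_tail, vertexDeriv_head]
  rw [hd (left_mem_Icc.2 (hℓ e).le), hd (right_mem_Icc.2 (hℓ e).le)]
  simp only [conj_expSol, map_neg, map_mul, map_pow, mul_neg, sub_neg_eq_add] at h ⊢
  rw [show ∫ x in Icc 0 (ℓ e), expSol ((starRingEnd ℂ) κ)
      ((starRingEnd ℂ) (c e).1, (starRingEnd ℂ) (c e).2) x *
        (secondDeriv (ℓ e) (f e) x + -((starRingEnd ℂ) κ) ^ 2 * f e x) = _ from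
    integral_congr_ae (Filter.Eventually.of_forall fun x => ?_), h]
  · simp only [neg_mul]; ring
  · simp only; ring

/-- Summation over the edges and their endpoints is summation over the vertices and their
incident edges. -/
theorem sum_endpoints_eq [G.LocallyFinite] [DecidableEq V] (o : Orientation G)
    (h : G.edgeSet → V → ℂ) {E : Finset G.edgeSet} (hE : ∀ e ∉ E, ∀ v, h e v = 0) :
    ∑ e ∈ E, (h e (o.tail e) + h e (o.head e)) =
      ∑ v ∈ E.image o.tail ∪ E.image o.head, ∑ w : G.neighborSet v, h (starEdge v w) v := by
  classical
  -- Writing the two endpoint terms as an incidence sum over one common finite vertex set allows the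
  -- order of summation to be exchanged.
  have h1 : ∀ e ∈ E, h e (o.tail e) + h e (o.head e) =
      ∑ v ∈ E.image o.tail ∪ E.image o.head, if v ∈ e.1 then h e v else 0 := by
    intro e he
    rw [← Finset.sum_filter, ← Finset.sum_pair (o.head_ne_tail e).symm]
    refine Finset.sum_congr ?_ fun _ _ => rfl
    ext v
    simp only [Finset.mem_insert, Finset.mem_singleton, Finset.mem_filter, Finset.mem_union,
      Finset.mem_image, o.mem_iff]
    constructor
    · rintro (rfl | rfl)
      · exact ⟨Or.inl ⟨e, he, rfl⟩, Or.inl rfl⟩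
      · exact ⟨Or.inr ⟨e, he, rfl⟩, Or.inr rfl⟩
    · exact fun h => h.2
  rw [Finset.sum_congr rfl h1, Finset.sum_comm]
  refine Finset.sum_congr rfl fun v _ => ?_
  rw [← Finset.sum_filter, ← Finset.sum_image (s := Finset.univ) (g := starEdge v)
    (f := fun e => h e v) (fun w _ w' _ hw => starEdge_injective v hw)]
  refine Finset.sum_subset (fun e he => ?_) fun e he he' => ?_
  · obtain ⟨w, hw⟩ := exists_starEdge_eq (Finset.mem_filter.1 he).2
    exact Finset.mem_image.2 ⟨w, Finset.mem_univ _, hw⟩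
  · obtain ⟨w, -, rfl⟩ := Finset.mem_image.1 he
    refine hE _ (fun h' => he' (Finset.mem_filter.2 ⟨h', mem_starEdge v w⟩)) v

/-- Continuity lets the vertex values of both functions be pulled out of the sum; what remains are
the two vanishing sums of derivatives. -/
theorem sum_boundaryForm_eq_zero [G.LocallyFinite] {o : Orientation G}
    {g f : G.edgeSet → ℝ → ℂ} {v : V} (hg : Kirchhoff o ℓ g v) (hf : Kirchhoff o ℓ f v) :
    ∑ w : G.neighborSet v, boundaryForm o ℓ g f (starEdge v w) v = 0 := by
  rcases isEmpty_or_nonempty (G.neighborSet v) with h | ⟨⟨w₀⟩⟩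
  · simp
  have : ∀ w : G.neighborSet v, boundaryForm o ℓ g f (starEdge v w) v =
      (starRingEnd ℂ) (vertexDeriv o ℓ g (starEdge v w) v) *
        vertexValue o ℓ f (starEdge v w₀) v -
      (starRingEnd ℂ) (vertexValue o ℓ g (starEdge v w₀) v) *
        vertexDeriv o ℓ f (starEdge v w) v := by
    intro w
    rw [boundaryForm, hf.1 w w₀, hg.1 w w₀]
  simp only [this]
  rw [Finset.sum_sub_distrib, ← Finset.sum_mul, ← Finset.mul_sum, hf.2, ← map_sum, hg.2]
  simp

/-! ### Test functions supported on a star -/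

/-- A cubic polynomial with value `a` and derivative `b` at `0` and vanishing Cauchy data
at `L`. -/
def cubic (L : ℝ) (a b : ℂ) (x : ℝ) : ℂ := (a + (b + 2 * a / L) * x) * (1 - x / L) ^ 2

def cubicDeriv (L : ℝ) (a b : ℂ) (x : ℝ) : ℂ :=
  (b + 2 * a / L) * (1 - x / L) ^ 2 - 2 / L * (a + (b + 2 * a / L) * x) * (1 - x / L)

def cubicDeriv₂ (L : ℝ) (a b : ℂ) (x : ℝ) : ℂ :=
  -4 / L * (b + 2 * a / L) * (1 - x / L) + 2 / L ^ 2 * (a + (b + 2 * a / L) * x)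

theorem hasDerivAt_cubic (L : ℝ) (a b : ℂ) (x : ℝ) :
    HasDerivAt (cubic L a b) (cubicDeriv L a b x) x := by
  have hx : HasDerivAt (fun x : ℝ => (x : ℂ)) 1 x := (hasDerivAt_id x).ofReal_comp
  have h1 := (hx.const_mul (b + 2 * a / L)).const_add a
  have h2 := ((hx.div_const (L : ℂ)).const_sub 1).pow 2
  convert! h1.mul h2 using 1
  simp only [cubicDeriv, Pi.pow_apply]
  push_cast
  ring

theorem hasDerivAt_cubicDeriv (L : ℝ) (a b : ℂ) (x : ℝ) :
    HasDerivAt (cubicDeriv L a b) (cubicDeriv₂ L a b x) x := by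
  have hx : HasDerivAt (fun x : ℝ => (x : ℂ)) 1 x := (hasDerivAt_id x).ofReal_comp
  have h1 := (hx.const_mul (b + 2 * a / L)).const_add a
  have h2 := (hx.div_const (L : ℂ)).const_sub 1
  convert! ((h2.pow 2).const_mul (b + 2 * a / L)).sub ((h1.const_mul (2 / (L : ℂ))).mul h2) using 1
  simp only [cubicDeriv₂]
  push_cast
  ring

theorem continuous_cubicDeriv₂ (L : ℝ) (a b : ℂ) : Continuous (cubicDeriv₂ L a b) := by
  unfold cubicDeriv₂
  fun_prop

open scoped Classical in
/-- A function supported on the star of `v`, with value `s` at `v` and with derivative `T e`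
at `v` along the edge `e`. -/
def starFun (o : Orientation G) (ℓ : G.edgeSet → ℝ) (v : V) (s : ℂ) (T : G.edgeSet → ℂ)
    (e : G.edgeSet) (x : ℝ) : ℂ :=
  if v = o.tail e then cubic (ℓ e) s (T e) x
  else if v = o.head e then cubic (ℓ e) s (T e) (ℓ e - x) else 0

section

variable (o : Orientation G) (hℓ : ∀ e, 0 < ℓ e) (v : V) (s : ℂ) (T : G.edgeSet → ℂ)
  (e : G.edgeSet)

theorem starFun_of_notMem (h : v ∉ e.1) : starFun o ℓ v s T e = 0 := by
  rw [o.mem_iff, not_or] at h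
  ext x
  simp [starFun, h.1, h.2]

theorem starFun_tail (h : v = o.tail e) : starFun o ℓ v s T e = cubic (ℓ e) s (T e) := by
  ext x
  simp [starFun, h]

theorem starFun_head (h : v = o.head e) :
    starFun o ℓ v s T e = fun x => cubic (ℓ e) s (T e) (ℓ e - x) := by
  ext x
  simp [starFun, h, o.head_ne_tail]

theorem hasDerivAt_starFun_head (h : v = o.head e) (x : ℝ) :
    HasDerivAt (starFun o ℓ v s T e) (-cubicDeriv (ℓ e) s (T e) (ℓ e - x)) x := by
  rw [starFun_head o v s T e h]
  have := (hasDerivAt_cubic (ℓ e) s (T e) (ℓ e - x)).scomp x ((hasDerivAt_id x).const_sub (ℓ e))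
  convert! this using 1
  simp

include hℓ in
theorem memH2_starFun : MemH2 (ℓ e) (starFun o ℓ v s T e) := by
  by_cases h0 : v = o.tail e
  · rw [starFun_tail o v s T e h0]
    exact MemH2.of_contDiff (hℓ e) (hasDerivAt_cubic _ _ _) (hasDerivAt_cubicDeriv _ _ _)
      (continuous_cubicDeriv₂ _ _ _)
  by_cases h1 : v = o.head e
  · refine MemH2.of_contDiff (f₂ := fun x => cubicDeriv₂ (ℓ e) s (T e) (ℓ e - x)) (hℓ e)
      (hasDerivAt_starFun_head o v s T e h1) (fun x => ?_)
      ((continuous_cubicDeriv₂ _ _ _).comp (by fun_prop))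
    have := ((hasDerivAt_cubicDeriv (ℓ e) s (T e) (ℓ e - x)).scomp x
      ((hasDerivAt_id x).const_sub (ℓ e))).neg
    convert! this using 1
    simp
  · rw [starFun_of_notMem o v s T e (by simp [o.mem_iff, h0, h1])]
    exact MemH2.zero _

include hℓ in
theorem vertexValue_starFun [DecidableEq V] {v' : V} (h : v' ∈ e.1) :
    vertexValue o ℓ (starFun o ℓ v s T) e v' = if v' = v then s else 0 := by
  have hne : (ℓ e : ℂ) ≠ 0 := by exact_mod_cast (hℓ e).ne'
  by_cases hv : v ∈ e.1
  · rcases (o.mem_iff e v').1 h with rfl | rfl <;> rcases (o.mem_iff e v).1 hv with rfl | rfl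
    · simp [vertexValue_tail, starFun_tail, cubic]
    · simp [vertexValue_tail, starFun_head, cubic, (o.head_ne_tail e).symm, hne]
    · simp [vertexValue_head, starFun_tail, cubic, o.head_ne_tail e, hne]
    · simp [vertexValue_head, starFun_head, cubic]
  · rw [vertexValue_of_eq_zero o (starFun_of_notMem o v s T e hv), if_neg]
    rintro rfl
    exact hv h

include hℓ in
theorem vertexDeriv_starFun [DecidableEq V] {v' : V} (h : v' ∈ e.1) :
    vertexDeriv o ℓ (starFun o ℓ v s T) e v' = if v' = v then T e else 0 := by
  have hne : (ℓ e : ℂ) ≠ 0 := by exact_mod_cast (hℓ e).ne'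
  have h0 := left_mem_Icc.2 (hℓ e).le
  have h1 := right_mem_Icc.2 (hℓ e).le
  have ht := derivWithin_eqOn (hℓ e)
    fun x _ => (hasDerivAt_cubic (ℓ e) s (T e) x).hasDerivWithinAt
  by_cases hv : v ∈ e.1
  · rcases (o.mem_iff e v').1 h with rfl | rfl <;> rcases (o.mem_iff e v).1 hv with rfl | rfl
    · rw [vertexDeriv_tail, starFun_tail o _ s T e rfl, ht h0]
      simp [cubicDeriv]; ring
    · have hh := derivWithin_eqOn (hℓ e)
        fun x _ => (hasDerivAt_starFun_head (ℓ := ℓ) o _ s T e rfl x).hasDerivWithinAt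
      rw [vertexDeriv_tail, hh h0]
      simp [cubicDeriv, (o.head_ne_tail e).symm, hne]
    · rw [vertexDeriv_head, starFun_tail o _ s T e rfl, ht h1]
      simp [cubicDeriv, o.head_ne_tail e, hne]
    · have hh := derivWithin_eqOn (hℓ e)
        fun x _ => (hasDerivAt_starFun_head (ℓ := ℓ) o _ s T e rfl x).hasDerivWithinAt
      rw [vertexDeriv_head, hh h1]
      simp [cubicDeriv]; ring
  · rw [vertexDeriv_of_eq_zero o (starFun_of_notMem o v s T e hv), if_neg]
    rintro rfl
    exact hv h

include hℓ in
-- At every vertex other than `v` the Cauchy data vanish, and at `v` continuity is built in, so the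
-- sum of the slopes is the only constraint.
theorem kirchhoff_starFun [G.LocallyFinite]
    (hT : ∑ w : G.neighborSet v, T (starEdge v w) = 0) (v' : V) :
    Kirchhoff o ℓ (starFun o ℓ v s T) v' := by
  classical
  refine ⟨fun w w' => ?_, ?_⟩
  · rw [vertexValue_starFun o hℓ v s T _ (mem_starEdge v' w),
      vertexValue_starFun o hℓ v s T _ (mem_starEdge v' w')]
  · simp only [vertexDeriv_starFun o hℓ v s T _ (mem_starEdge v' _)]
    by_cases h : v' = v
    · subst h; simpa using hT
    · simp [h]

end

/-- The deficiency subspaces of the minimal Kirchhoff Laplacian consist of the square integrable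
solutions of `-f'' = z f` that satisfy the Kirchhoff conditions. -/
theorem mem_deficiencySubspace_iff_expSol [G.LocallyFinite] (o : Orientation G)
    (hℓ : ∀ e, 0 < ℓ e) {κ : ℂ} (hκ : κ ≠ 0) (u : L2 G ℓ) :
    u ∈ deficiencySubspace (minimalLaplacian o hℓ) (-κ ^ 2) ↔
      ∃ c : G.edgeSet → ℂ × ℂ,
        (∀ e, u e =ᵐ[volume.restrict (Icc 0 (ℓ e))] expSol κ (c e)) ∧
        ∀ v, Kirchhoff o ℓ (fun e => expSol κ (c e)) v := by
  classical
  rw [mem_deficiencySubspace_minimalLaplacian_iff]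
  have green : ∀ c : G.edgeSet → ℂ × ℂ,
      (∀ e, u e =ᵐ[volume.restrict (Icc 0 (ℓ e))] expSol κ (c e)) →
      ∀ (f : G.edgeSet → ℝ → ℂ) (E : Finset G.edgeSet), (∀ e, MemH2 (ℓ e) (f e)) →
      ∑ e ∈ E, ∫ x in Icc 0 (ℓ e), (starRingEnd ℂ) (u e x) *
          (secondDeriv (ℓ e) (f e) x + (starRingEnd ℂ) (-κ ^ 2) * f e x) =
        ∑ e ∈ E, (boundaryForm o ℓ (fun e => expSol κ (c e)) f e (o.tail e) +
          boundaryForm o ℓ (fun e => expSol κ (c e)) f e (o.head e)) := by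
    intro c hc f E hf
    refine Finset.sum_congr rfl fun e _ => ?_
    rw [← integral_expSol_green o hℓ κ c (hf e)]
    refine integral_congr_ae ?_
    filter_upwards [hc e] with x hx
    rw [hx]
  constructor
  · intro h
    have hedge : ∀ e, ∃ c : ℂ × ℂ, u e =ᵐ[volume.restrict (Icc 0 (ℓ e))] expSol κ c := by
      intro e
      -- A function on one edge with vanishing Cauchy data, extended by zero, is an admissible test
      -- function.
      refine exists_expSol_ae_eq (hℓ e) hκ (u e) fun φ hφ φ0 φL φ0' φL' => ?_
      set f : G.edgeSet → ℝ → ℂ := Pi.single e φ with hf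
      have hne : ∀ e' ≠ e, f e' = 0 := fun e' h => Pi.single_eq_of_ne h _
      have heq : f e = φ := Pi.single_eq_same _ _
      have hfH : ∀ e', MemH2 (ℓ e') (f e') := by
        intro e'
        by_cases h : e' = e
        · subst h; rw [heq]; exact hφ
        · rw [hne e' h]; exact MemH2.zero _
      have hk : ∀ v, Kirchhoff o ℓ f v := by
        refine Kirchhoff.of_eq_zero ?_ ?_ ?_ ?_ <;> intro e' <;> by_cases h : e' = e <;>
          first
          | (subst h; rw [heq]; assumption)
          | simp [hne e' h]
      have := h f {e} hfH hk fun e' he' => hne e' (by simpa using he')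
      rw [Finset.sum_singleton, heq] at this
      rw [← this]
      refine integral_congr_ae (Filter.Eventually.of_forall fun x => ?_)
      simp only [map_neg]
      ring
    choose c hc using hedge
    refine ⟨c, hc, fun v => ?_⟩
    -- Star functions isolate the boundary form at `v`, with a free value `s` and free slopes `T` of
    -- sum zero.
    have test : ∀ (s : ℂ) (T : G.edgeSet → ℂ), ∑ w : G.neighborSet v, T (starEdge v w) = 0 →
        ∑ w : G.neighborSet v,
          ((starRingEnd ℂ) (vertexDeriv o ℓ (fun e => expSol κ (c e)) (starEdge v w) v) * s -
          (starRingEnd ℂ) (vertexValue o ℓ (fun e => expSol κ (c e)) (starEdge v w) v) *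
            T (starEdge v w)) = 0 := by
      intro s T hT
      have h0 : ∀ e ∉ Finset.univ.image (starEdge (G := G) v), starFun o ℓ v s T e = 0 := by
        intro e he
        refine starFun_of_notMem o v s T e fun hv => he ?_
        obtain ⟨w, hw⟩ := exists_starEdge_eq hv
        exact Finset.mem_image.2 ⟨w, Finset.mem_univ _, hw⟩
      have hz := h (starFun o ℓ v s T) (Finset.univ.image (starEdge v))
        (memH2_starFun o hℓ v s T) (kirchhoff_starFun o hℓ v s T hT) h0
      rw [green c hc _ _ (memH2_starFun o hℓ v s T),
        Finset.sum_image fun w _ w' _ hw => starEdge_injective v hw] at hz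
      rw [← hz]
      refine Finset.sum_congr rfl fun w _ => ?_
      set e := starEdge v w
      have ht : o.tail e ∈ e.1 := (o.mem_iff e _).2 (Or.inl rfl)
      have hh : o.head e ∈ e.1 := (o.mem_iff e _).2 (Or.inr rfl)
      simp only [boundaryForm, vertexValue_starFun o hℓ v s T e ht,
        vertexValue_starFun o hℓ v s T e hh, vertexDeriv_starFun o hℓ v s T e ht,
        vertexDeriv_starFun o hℓ v s T e hh]
      rcases (o.mem_iff e v).1 (mem_starEdge v w) with hv | hv
      · have : o.head e ≠ v := hv ▸ o.head_ne_tail e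
        rw [if_pos hv.symm, if_pos hv.symm, if_neg this, if_neg this, ← hv]
        ring
      · have : o.tail e ≠ v := hv ▸ (o.head_ne_tail e).symm
        rw [if_pos hv.symm, if_pos hv.symm, if_neg this, if_neg this, ← hv]
        ring
    refine ⟨fun w w' => ?_, ?_⟩
    · by_cases hww : w = w'
      · rw [hww]
      -- Opposite slopes on two edges compare the two values at `v`, which is continuity.
      have := test 0 (fun e => (if e = starEdge v w then 1 else 0) -
        (if e = starEdge v w' then 1 else 0)) (by
          simp [(starEdge_injective (G := G) v).eq_iff])
      simp only [mul_zero, (starEdge_injective (G := G) v).eq_iff, zero_sub, mul_sub, mul_ite,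
        mul_one, neg_sub, Finset.sum_sub_distrib, Finset.sum_ite_eq', Finset.mem_univ, if_true,
        sub_eq_zero] at this
      exact ((starRingEnd ℂ).injective this).symm
    -- Value `1` with zero slopes leaves the conjugate of the sum of derivatives.
    · have := test 1 0 (by simp)
      simp only [Pi.zero_apply, mul_one, mul_zero, sub_zero] at this
      rw [← map_sum] at this
      exact (map_eq_zero (starRingEnd ℂ)).1 this
  · rintro ⟨c, hc, hk⟩ f E hf kf hE
    rw [green c hc f E hf, sum_endpoints_eq o _ (E := E)]
    · exact Finset.sum_eq_zero fun v _ => sum_boundaryForm_eq_zero (hk v) (kf v)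
    · intro e he v
      simp [boundaryForm, vertexValue_of_eq_zero o (hE e he), vertexDeriv_of_eq_zero o (hE e he)]

end

section

/-! ### Solutions on an edge in terms of their boundary values -/

/-- The solution of `f'' = κ² f` with `f 0 = 0` and `f' 0 = 1`. -/
def sinSol (κ : ℂ) (x : ℝ) : ℂ := Complex.sinh (κ * x) / κ

/-- The solution of `f'' = κ² f` with `f 0 = 1` and `f' 0 = 0`. -/
def cosSol (κ : ℂ) (x : ℝ) : ℂ := Complex.cosh (κ * x)

/-- The coefficients of the solution with boundary values `a` at `0` and `b` at `L`. -/
def dirichletCoeff (κ : ℂ) (L : ℝ) (a b : ℂ) : ℂ × ℂ :=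
  ((b - a * Complex.exp (-κ * L)) / (2 * Complex.sinh (κ * L)),
    (a * Complex.exp (κ * L) - b) / (2 * Complex.sinh (κ * L)))

section

variable {κ : ℂ} {L : ℝ}

theorem sinh_ne_zero_of_sinSol_ne_zero (h : sinSol κ L ≠ 0) : Complex.sinh (κ * L) ≠ 0 :=
  fun h' => h (by simp [sinSol, h'])

theorem exp_eq_cosh_add_sinh (κ : ℂ) (L : ℝ) :
    Complex.exp (κ * L) = Complex.cosh (κ * L) + Complex.sinh (κ * L) :=
  (Complex.cosh_add_sinh _).symm

theorem exp_neg_eq_cosh_sub_sinh (κ : ℂ) (L : ℝ) :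
    Complex.exp (-κ * L) = Complex.cosh (κ * L) - Complex.sinh (κ * L) := by
  rw [neg_mul, Complex.cosh_sub_sinh]

theorem expSol_dirichletCoeff_zero (h : sinSol κ L ≠ 0) (a b : ℂ) :
    expSol κ (dirichletCoeff κ L a b) 0 = a := by
  have := sinh_ne_zero_of_sinSol_ne_zero h
  simp only [expSol, dirichletCoeff, exp_neg_eq_cosh_sub_sinh]
  simp only [exp_eq_cosh_add_sinh]
  simp only [Complex.ofReal_zero, mul_zero, Complex.cosh_zero, Complex.sinh_zero]
  field_simp
  ring

theorem expSol_dirichletCoeff_right (h : sinSol κ L ≠ 0) (a b : ℂ) :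
    expSol κ (dirichletCoeff κ L a b) L = b := by
  have := sinh_ne_zero_of_sinSol_ne_zero h
  simp only [expSol, dirichletCoeff, exp_neg_eq_cosh_sub_sinh]
  simp only [exp_eq_cosh_add_sinh]
  field_simp
  ring

theorem expSol_dirichletCoeff_eq (hκ : κ ≠ 0) (h : sinSol κ L ≠ 0) (a b : ℂ) (x : ℝ) :
    expSol κ (dirichletCoeff κ L a b) x =
      (a * sinSol κ (L - x) + b * sinSol κ x) / sinSol κ L := by
  have := sinh_ne_zero_of_sinSol_ne_zero h
  simp only [expSol, dirichletCoeff, exp_neg_eq_cosh_sub_sinh]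
  simp only [exp_eq_cosh_add_sinh, sinSol,
    Complex.ofReal_sub, mul_sub, Complex.sinh_sub]
  field_simp
  ring

theorem deriv_dirichletCoeff_zero (h : sinSol κ L ≠ 0) (hκ : κ ≠ 0) (a b : ℂ) :
    expSol κ (κ * (dirichletCoeff κ L a b).1, -κ * (dirichletCoeff κ L a b).2) 0 =
      (b - cosSol κ L * a) / sinSol κ L := by
  have := sinh_ne_zero_of_sinSol_ne_zero h
  simp only [expSol, dirichletCoeff, exp_neg_eq_cosh_sub_sinh]
  simp only [exp_eq_cosh_add_sinh, sinSol, cosSol]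
  simp only [Complex.ofReal_zero, mul_zero, Complex.cosh_zero, Complex.sinh_zero]
  field_simp
  ring

/-- By `cosh² - sinh² = 1` the outgoing derivative at `L` is that at `0` with `a` and `b` exchanged.
This symmetry removes the orientation from the discrete equation. -/
theorem deriv_dirichletCoeff_right (h : sinSol κ L ≠ 0) (hκ : κ ≠ 0) (a b : ℂ) :
    -expSol κ (κ * (dirichletCoeff κ L a b).1, -κ * (dirichletCoeff κ L a b).2) L =
      (a - cosSol κ L * b) / sinSol κ L := by
  have := sinh_ne_zero_of_sinSol_ne_zero h
  have h2 := Complex.cosh_sq_sub_sinh_sq (κ * L)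
  simp only [expSol, dirichletCoeff, exp_neg_eq_cosh_sub_sinh]
  simp only [exp_eq_cosh_add_sinh, sinSol, cosSol]
  field_simp
  linear_combination (2 * a) * h2

/-- A solution on an edge is determined by its two boundary values because `sinh (κ L) ≠ 0`. -/
theorem dirichletCoeff_expSol (h : sinSol κ L ≠ 0) (c : ℂ × ℂ) :
    dirichletCoeff κ L (expSol κ c 0) (expSol κ c L) = c := by
  have := sinh_ne_zero_of_sinSol_ne_zero h
  refine Prod.ext ?_ ?_ <;>
  · simp only [expSol, dirichletCoeff, exp_neg_eq_cosh_sub_sinh]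
    simp only [exp_eq_cosh_add_sinh]
    simp only [Complex.ofReal_zero, mul_zero, Complex.cosh_zero, Complex.sinh_zero]
    field_simp
    ring

theorem expSol_dirichletCoeff_linear (κ : ℂ) (L : ℝ) (a b : ℂ) (x : ℝ) :
    expSol κ (dirichletCoeff κ L a b) x = a * expSol κ (dirichletCoeff κ L 1 0) x +
      b * expSol κ (dirichletCoeff κ L 0 1) x := by
  simp only [expSol, dirichletCoeff]
  ring

end

/-! ### Reduction to functions on the vertices -/

variable {V : Type*} {G : SimpleGraph V} {ℓ : G.edgeSet → ℝ}

/-- The function on the metric graph that interpolates the vertex values `x` by solutions of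
`f'' = κ² f`. -/
def interpolation (o : Orientation G) (ℓ : G.edgeSet → ℝ) (κ : ℂ) (x : V → ℂ)
    (e : G.edgeSet) : ℝ → ℂ :=
  expSol κ (dirichletCoeff κ (ℓ e) (x (o.tail e)) (x (o.head e)))

theorem memLp_expSol (L : ℝ) (κ : ℂ) (c : ℂ × ℂ) :
    MemLp (expSol κ c) 2 (volume.restrict (Icc 0 L)) :=
  memLp_of_continuousOn (continuous_expSol κ c).continuousOn

/-- The interpolation on the edge `e` as a linear map into `L²(e)`. -/
def interpolationLp (o : Orientation G) (ℓ : G.edgeSet → ℝ) (κ : ℂ) (e : G.edgeSet) :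
    (V → ℂ) →ₗ[ℂ] Lp ℂ 2 (volume.restrict (Icc 0 (ℓ e))) :=
  (LinearMap.proj (o.tail e)).smulRight
      (memLp_expSol (ℓ e) κ (dirichletCoeff κ (ℓ e) 1 0)).toLp +
    (LinearMap.proj (o.head e)).smulRight
      (memLp_expSol (ℓ e) κ (dirichletCoeff κ (ℓ e) 0 1)).toLp

theorem interpolationLp_ae_eq (o : Orientation G) (κ : ℂ) (x : V → ℂ) (e : G.edgeSet) :
    interpolationLp o ℓ κ e x =ᵐ[volume.restrict (Icc 0 (ℓ e))] interpolation o ℓ κ x e := by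
  set A := (memLp_expSol (ℓ e) κ (dirichletCoeff κ (ℓ e) 1 0)).toLp
  set B := (memLp_expSol (ℓ e) κ (dirichletCoeff κ (ℓ e) 0 1)).toLp
  have : interpolationLp o ℓ κ e x = x (o.tail e) • A + x (o.head e) • B := rfl
  rw [this]
  filter_upwards [Lp.coeFn_add (x (o.tail e) • A) (x (o.head e) • B),
    Lp.coeFn_smul (x (o.tail e)) A, Lp.coeFn_smul (x (o.head e)) B,
    (memLp_expSol (ℓ e) κ (dirichletCoeff κ (ℓ e) 1 0)).coeFn_toLp,
    (memLp_expSol (ℓ e) κ (dirichletCoeff κ (ℓ e) 0 1)).coeFn_toLp] with t h1 h2 h3 h4 h5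
  rw [h1, Pi.add_apply, h2, h3, Pi.smul_apply, Pi.smul_apply, h4, h5, interpolation,
    expSol_dirichletCoeff_linear κ (ℓ e) (x (o.tail e)) (x (o.head e))]
  rfl

/-- The discrete equation for the vertex values of a solution of `f'' = κ² f` subject to the
Kirchhoff conditions. -/
def DiscreteSolution [G.LocallyFinite] (ℓ : G.edgeSet → ℝ) (κ : ℂ) (x : V → ℂ) : Prop :=
  ∀ v, ∑ w : G.neighborSet v, (x w - cosSol κ (ℓ (starEdge v w)) * x v) /
    sinSol κ (ℓ (starEdge v w)) = 0

/-- The vertex values of the square integrable solutions. -/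
def solutionSpace [G.LocallyFinite] (o : Orientation G) (ℓ : G.edgeSet → ℝ) (κ : ℂ) :
    Submodule ℂ (V → ℂ) where
  carrier := {x | DiscreteSolution ℓ κ x ∧ Memℓp (fun e => interpolationLp o ℓ κ e x) 2}
  zero_mem' := by
    refine ⟨fun v => by simp, ?_⟩
    simp only [map_zero]
    exact zero_memℓp
  add_mem' := by
    rintro x y ⟨hx, hx'⟩ ⟨hy, hy'⟩
    refine ⟨fun v => ?_, ?_⟩
    · rw [← add_zero (0 : ℂ)]
      nth_rw 1 [← hx v]
      rw [← hy v, ← Finset.sum_add_distrib]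
      refine Finset.sum_congr rfl fun w _ => ?_
      simp only [Pi.add_apply]
      ring
    · simp only [map_add]
      exact hx'.add hy'
  smul_mem' := by
    rintro c x ⟨hx, hx'⟩
    refine ⟨fun v => ?_, ?_⟩
    · rw [← mul_zero c, ← hx v, Finset.mul_sum]
      refine Finset.sum_congr rfl fun w _ => ?_
      simp only [Pi.smul_apply, smul_eq_mul]
      ring
    · simp only [map_smul]
      exact hx'.const_smul c

section

variable (o : Orientation G) (hℓ : ∀ e, 0 < ℓ e) {κ : ℂ} (hκ : κ ≠ 0)
  (hS : ∀ e, sinSol κ (ℓ e) ≠ 0)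

include hS in
theorem vertexValue_interpolation (x : V → ℂ) {e : G.edgeSet} {v : V} (h : v ∈ e.1) :
    vertexValue o ℓ (interpolation o ℓ κ x) e v = x v := by
  rcases (o.mem_iff e v).1 h with rfl | rfl
  · rw [vertexValue_tail, interpolation, expSol_dirichletCoeff_zero (hS e)]
  · rw [vertexValue_head, interpolation, expSol_dirichletCoeff_right (hS e)]

include hℓ hκ hS in
theorem vertexDeriv_interpolation (x : V → ℂ) (v : V) (w : G.neighborSet v) :
    vertexDeriv o ℓ (interpolation o ℓ κ x) (starEdge v w) v =
      (x w - cosSol κ (ℓ (starEdge v w)) * x v) / sinSol κ (ℓ (starEdge v w)) := by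
  set e := starEdge v w with he
  have hmk : s(o.tail e, o.head e) = s(v, w.1) := o.mk_eq e
  rcases Sym2.eq_iff.1 hmk with ⟨h1, h2⟩ | ⟨h1, h2⟩
  · have : vertexDeriv o ℓ (interpolation o ℓ κ x) e v =
        vertexDeriv o ℓ (interpolation o ℓ κ x) e (o.tail e) := by rw [h1]
    rw [this, vertexDeriv_tail, interpolation, derivWithin_expSol (hℓ e) κ _ (left_mem_Icc.2 (hℓ e).le),
      deriv_dirichletCoeff_zero (hS e) hκ, h1, h2]
  · have : vertexDeriv o ℓ (interpolation o ℓ κ x) e v =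
        vertexDeriv o ℓ (interpolation o ℓ κ x) e (o.head e) := by rw [h2]
    rw [this, vertexDeriv_head, interpolation, derivWithin_expSol (hℓ e) κ _ (right_mem_Icc.2 (hℓ e).le),
      deriv_dirichletCoeff_right (hS e) hκ, h1, h2]

include hℓ hκ hS in
theorem kirchhoff_interpolation_iff [G.LocallyFinite] (x : V → ℂ) :
    (∀ v, Kirchhoff o ℓ (interpolation o ℓ κ x) v) ↔ DiscreteSolution ℓ κ x := by
  refine forall_congr' fun v => ?_
  simp only [Kirchhoff, vertexDeriv_interpolation o hℓ hκ hS x,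
    vertexValue_interpolation o hS x (mem_starEdge v _), implies_true, true_and]

include hℓ hκ hS in
/-- The dimension of the deficiency subspace is the dimension of the space of vertex values. -/
theorem rank_deficiencySubspace_eq [G.LocallyFinite] (hG : ∀ v, Nonempty (G.neighborSet v)) :
    Module.rank ℂ (deficiencySubspace (minimalLaplacian o hℓ) (-κ ^ 2)) =
      Module.rank ℂ (solutionSpace o ℓ κ) := by
  set Φ : solutionSpace o ℓ κ →ₗ[ℂ] L2 G ℓ :=
    { toFun := fun x => ⟨fun e => interpolationLp o ℓ κ e x.1, x.2.2⟩
      map_add' := fun x y => by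
        ext1
        funext e
        exact map_add (interpolationLp o ℓ κ e) x.1 y.1
      map_smul' := fun c x => by
        ext1
        funext e
        exact map_smul (interpolationLp o ℓ κ e) c x.1 } with hΦ
  have hval : ∀ x : solutionSpace o ℓ κ, ∀ e,
      Φ x e =ᵐ[volume.restrict (Icc 0 (ℓ e))] interpolation o ℓ κ x.1 e :=
    fun x e => interpolationLp_ae_eq o κ x.1 e
  have hmem : ∀ x, Φ x ∈ deficiencySubspace (minimalLaplacian o hℓ) (-κ ^ 2) := fun x =>
    (mem_deficiencySubspace_iff_expSol o hℓ hκ _).2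
      ⟨fun e => dirichletCoeff κ (ℓ e) (x.1 (o.tail e)) (x.1 (o.head e)), hval x,
        (kirchhoff_interpolation_iff o hℓ hκ hS x.1).2 x.2.1⟩
  refine (LinearEquiv.ofBijective (Φ.codRestrict _ hmem) ⟨?_, ?_⟩).symm.rank_eq
  · rw [← LinearMap.ker_eq_bot, LinearMap.ker_codRestrict, LinearMap.ker_eq_bot']
    intro x hx
    refine Subtype.ext (funext fun v => ?_)
    obtain ⟨w⟩ := hG v
    have h0 : interpolation o ℓ κ x.1 (starEdge v w)
        =ᵐ[volume.restrict (Icc 0 (ℓ (starEdge v w)))] 0 := by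
      refine (hval x _).symm.trans ?_
      rw [hx]
      exact Lp.coeFn_zero _ _ _
    have h1 := Measure.eqOn_Icc_of_ae_eq volume (hℓ _).ne h0
      (continuous_expSol _ _).continuousOn continuousOn_const
    rw [← vertexValue_interpolation o hS x.1 (mem_starEdge v w), vertexValue]
    split_ifs
    · exact h1 (left_mem_Icc.2 (hℓ _).le)
    · exact h1 (right_mem_Icc.2 (hℓ _).le)
  · rintro ⟨u, hu⟩
    obtain ⟨c, hc, hk⟩ := (mem_deficiencySubspace_iff_expSol o hℓ hκ u).1 hu
    set g : G.edgeSet → ℝ → ℂ := fun e => expSol κ (c e) with hg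
    -- The value at `v` is read off along an arbitrary incident edge; continuity makes the choice
    -- immaterial.
    set x : V → ℂ := fun v => vertexValue o ℓ g (starEdge v (Classical.choice (hG v))) v with hx
    have hxv : ∀ e v, v ∈ e.1 → vertexValue o ℓ g e v = x v := by
      intro e v hv
      obtain ⟨w, rfl⟩ := exists_starEdge_eq hv
      exact (hk v).1 w _
    have hgx : g = interpolation o ℓ κ x := by
      funext e
      rw [interpolation, ← hxv e _ ((o.mem_iff e _).2 (Or.inl rfl)),
        ← hxv e _ ((o.mem_iff e _).2 (Or.inr rfl)), vertexValue_tail, vertexValue_head,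
        dirichletCoeff_expSol (hS e)]
    have hux : ∀ e, u e = interpolationLp o ℓ κ e x := by
      intro e
      refine Lp.ext ((hc e).trans ?_)
      refine Filter.EventuallyEq.trans ?_ (interpolationLp_ae_eq o κ x e).symm
      rw [← hgx]
    have hxs : x ∈ solutionSpace o ℓ κ := by
      refine ⟨(kirchhoff_interpolation_iff o hℓ hκ hS x).1 (hgx ▸ hk), ?_⟩
      have := lp.memℓp u
      rwa [show (u : ∀ e, _) = fun e => interpolationLp o ℓ κ e x from funext hux] at this
    refine ⟨⟨x, hxs⟩, Subtype.ext (lp.ext (funext fun e => (hux e).symm))⟩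

end

/-- A sufficient condition for square integrability. -/
theorem memℓp_interpolationLp (o : Orientation G) (hℓ : ∀ e, 0 < ℓ e) {κ : ℂ} (hκ : κ ≠ 0)
    (hS : ∀ e, sinSol κ (ℓ e) ≠ 0) {K : ℝ}
    (hK : ∀ e, ∀ t ∈ Icc 0 (ℓ e), ‖sinSol κ t‖ ≤ K * ‖sinSol κ (ℓ e)‖)
    {x : V → ℂ} {M : G.edgeSet → ℝ} (hM : ∀ e, ∀ v ∈ e.1, ‖x v‖ ≤ M e)
    (hsum : Summable fun e => ℓ e * M e ^ 2) :
    Memℓp (fun e => interpolationLp o ℓ κ e x) 2 := by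
  rw [memℓp_gen_iff (by norm_num)]
  have hb : ∀ e, ‖interpolationLp o ℓ κ e x‖ ^ 2 ≤ (2 * K) ^ 2 * (ℓ e * M e ^ 2) := by
    intro e
    have hM0 : 0 ≤ M e := (norm_nonneg _).trans (hM e (o.tail e) ((o.mem_iff e _).2 (Or.inl rfl)))
    have hbound : ∀ᵐ t ∂(volume.restrict (Icc 0 (ℓ e))),
        ‖interpolationLp o ℓ κ e x t‖ ≤ 2 * K * M e := by
      filter_upwards [interpolationLp_ae_eq o κ x e, ae_restrict_mem measurableSet_Icc] with t h1 ht
      have hpos : 0 < ‖sinSol κ (ℓ e)‖ := norm_pos_iff.2 (hS e)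
      rw [h1, interpolation, expSol_dirichletCoeff_eq hκ (hS e), norm_div, div_le_iff₀ hpos]
      refine (norm_add_le _ _).trans ?_
      rw [norm_mul, norm_mul]
      have e1 := mul_le_mul (hM e _ ((o.mem_iff e (o.tail e)).2 (Or.inl rfl)))
        (hK e (ℓ e - t) ⟨by linarith [ht.2], by linarith [ht.1]⟩) (norm_nonneg _) hM0
      have e2 := mul_le_mul (hM e _ ((o.mem_iff e (o.head e)).2 (Or.inr rfl)))
        (hK e t ht) (norm_nonneg _) hM0
      linarith
    -- The sign of `K` is not assumed; it is enough that the almost everywhere bound holds at some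
    -- point, as the edge has positive length.
    have hnn : 0 ≤ 2 * K * M e := by
      have hne : (ae (volume.restrict (Icc 0 (ℓ e)))).NeBot := by
        rw [ae_neBot, Ne, Measure.restrict_eq_zero]
        simp [hℓ e]
      obtain ⟨t, ht⟩ := hbound.exists
      exact (norm_nonneg _).trans ht
    have h1 := Lp.norm_le_of_ae_bound hnn hbound
    have h2 := pow_le_pow_left₀ (norm_nonneg _) h1 2
    refine h2.trans (le_of_eq ?_)
    have hvol : (measureUnivNNReal (volume.restrict (Icc 0 (ℓ e))) : ℝ) = ℓ e := by
      change (volume.restrict (Icc 0 (ℓ e)) univ).toReal = ℓ e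
      simp [(hℓ e).le]
    rw [hvol, mul_pow, ← Real.rpow_natCast (ℓ e ^ _), ← Real.rpow_mul (hℓ e).le]
    norm_num
    ring
  simp only [ENNReal.toReal_ofNat, Real.rpow_ofNat]
  exact Summable.of_nonneg_of_le (fun e => by positivity) hb (hsum.mul_left _)

end

/-! ### Short edges -/

section

variable {κ : ℂ} {L : ℝ}

theorem norm_mul_ofReal (hκ : ‖κ‖ = 1) (h0 : 0 ≤ L) : ‖κ * L‖ = L := by
  rw [norm_mul, hκ, one_mul, Complex.norm_of_nonneg h0]

/-- The bound `‖exp w - 1 - w‖ ≤ ‖w‖²` is used at `w = ±κ L`; halving the difference keeps the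
constant `1`. -/
theorem norm_sinSol_sub_le (hκ : ‖κ‖ = 1) (h0 : 0 ≤ L) (h1 : L ≤ 1) : ‖sinSol κ L - L‖ ≤ L ^ 2 := by
  have hκ0 : κ ≠ 0 := norm_ne_zero_iff.1 (by rw [hκ]; exact one_ne_zero)
  have hw := norm_mul_ofReal hκ h0
  have e1 := Complex.norm_exp_sub_one_sub_id_le (x := κ * L) (by rwa [hw])
  have e2 := Complex.norm_exp_sub_one_sub_id_le (x := -(κ * L)) (by rwa [norm_neg, hw])
  rw [norm_neg] at e2
  rw [hw] at e1 e2
  have : sinSol κ L - L = ((Complex.exp (κ * L) - 1 - κ * L) -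
      (Complex.exp (-(κ * L)) - 1 - -(κ * L))) / (2 * κ) := by
    rw [sinSol, Complex.sinh]
    field_simp
    ring
  rw [this, norm_div, norm_mul, hκ, div_le_iff₀ (by norm_num)]
  refine (norm_sub_le _ _).trans ?_
  rw [RCLike.norm_ofNat]
  linarith

theorem norm_cosSol_sub_le (hκ : ‖κ‖ = 1) (h0 : 0 ≤ L) (h1 : L ≤ 1) : ‖cosSol κ L - 1‖ ≤ L ^ 2 := by
  have hw := norm_mul_ofReal hκ h0
  have e1 := Complex.norm_exp_sub_one_sub_id_le (x := κ * L) (by rwa [hw])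
  have e2 := Complex.norm_exp_sub_one_sub_id_le (x := -(κ * L)) (by rwa [norm_neg, hw])
  rw [norm_neg] at e2
  rw [hw] at e1 e2
  have : cosSol κ L - 1 = ((Complex.exp (κ * L) - 1 - κ * L) +
      (Complex.exp (-(κ * L)) - 1 - -(κ * L))) / 2 := by
    rw [cosSol, Complex.cosh]
    ring
  rw [this, norm_div, div_le_iff₀ (by norm_num)]
  refine (norm_add_le _ _).trans ?_
  rw [RCLike.norm_ofNat]
  linarith

theorem norm_sinSol_le (hκ : ‖κ‖ = 1) (h0 : 0 ≤ L) (h1 : L ≤ 1 / 8) :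
    ‖sinSol κ L‖ ≤ 3 / 2 * L := by
  have h := norm_sinSol_sub_le hκ h0 (by linarith)
  have h2 := norm_le_norm_add_norm_sub' (sinSol κ L) L
  rw [Complex.norm_of_nonneg h0] at h2
  nlinarith

theorem le_norm_sinSol (hκ : ‖κ‖ = 1) (h0 : 0 ≤ L) (h1 : L ≤ 1 / 8) :
    7 / 8 * L ≤ ‖sinSol κ L‖ := by
  have h := norm_sinSol_sub_le hκ h0 (by linarith)
  have h2 := norm_le_norm_add_norm_sub (sinSol κ L) (L : ℂ)
  rw [Complex.norm_of_nonneg h0] at h2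
  nlinarith

theorem sinSol_ne_zero (hκ : ‖κ‖ = 1) (h0 : 0 < L) (h1 : L ≤ 1 / 8) : sinSol κ L ≠ 0 := by
  have := le_norm_sinSol hκ h0.le h1
  exact norm_pos_iff.1 (by linarith)

theorem norm_inv_sinSol_le (hκ : ‖κ‖ = 1) (h0 : 0 < L) (h1 : L ≤ 1 / 8) :
    ‖(sinSol κ L)⁻¹‖ ≤ 2 / L := by
  have := le_norm_sinSol hκ h0.le h1
  rw [norm_inv, ← one_div, div_le_div_iff₀ (by linarith) h0]
  linarith

theorem norm_cosSol_div_sinSol_le (hκ : ‖κ‖ = 1) (h0 : 0 < L) (h1 : L ≤ 1 / 8) :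
    ‖cosSol κ L / sinSol κ L‖ ≤ 3 / L := by
  have h2 := norm_cosSol_sub_le hκ h0.le (by linarith)
  have h3 := norm_le_norm_add_norm_sub' (cosSol κ L) 1
  rw [norm_one] at h3
  have h4 := norm_inv_sinSol_le hκ h0 h1
  rw [div_eq_mul_inv, norm_mul]
  have h5 : ‖cosSol κ L‖ ≤ 3 / 2 := by nlinarith
  calc ‖cosSol κ L‖ * ‖(sinSol κ L)⁻¹‖ ≤ 3 / 2 * (2 / L) := by gcongr
    _ = 3 / L := by ring

/-- The quotient differs from `1 / L ≥ 8` by at most `2 L + 2`. Positive real parts prevent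
cancellation in the diagonal of the discrete equation. -/
theorem re_cosSol_div_sinSol_pos (hκ : ‖κ‖ = 1) (h0 : 0 < L) (h1 : L ≤ 1 / 8) :
    0 < (cosSol κ L / sinSol κ L).re := by
  have h2 := norm_cosSol_sub_le hκ h0.le (by linarith)
  have h3 := norm_sinSol_sub_le hκ h0.le (by linarith)
  have h4 := norm_inv_sinSol_le hκ h0 h1
  have hne := sinSol_ne_zero hκ h0 h1
  have hL : (L : ℂ) ≠ 0 := by exact_mod_cast h0.ne'
  have e : cosSol κ L / sinSol κ L - ((1 / L : ℝ) : ℂ) =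
      ((cosSol κ L - 1) * L - (sinSol κ L - L)) / L * (sinSol κ L)⁻¹ := by
    push_cast
    field_simp
    ring
  have h5 : ‖cosSol κ L / sinSol κ L - ((1 / L : ℝ) : ℂ)‖ ≤ (L ^ 2 * L + L ^ 2) / L * (2 / L) := by
    rw [e, norm_mul, norm_div, Complex.norm_of_nonneg h0.le]
    gcongr
    refine (norm_sub_le _ _).trans ?_
    rw [norm_mul, Complex.norm_of_nonneg h0.le]
    gcongr
  have h6 := (Complex.abs_re_le_norm _).trans h5
  rw [Complex.sub_re, Complex.ofReal_re] at h6
  have h7 : (L ^ 2 * L + L ^ 2) / L * (2 / L) = 2 * L + 2 := by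
    field_simp
  have h8 : 8 ≤ 1 / L := by rw [le_div_iff₀ h0]; linarith
  have := (abs_le.1 h6).1
  linarith

end

/-! ### The edge lengths -/

/-- The length of the edges between vertices of different classes. -/
def longLength (k : ℕ) : ℝ := (1 / 10 ^ 6) ^ (k + 1)

/-- The length of the edges between vertices of the same class. -/
def shortLength (k : ℕ) : ℝ := longLength k ^ 2

theorem longLength_pos (k : ℕ) : 0 < longLength k := by unfold longLength; positivity

theorem shortLength_pos (k : ℕ) : 0 < shortLength k := pow_pos (longLength_pos k) 2

theorem longLength_le (k : ℕ) : longLength k ≤ 1 / 10 ^ 6 := by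
  unfold longLength
  exact pow_le_of_le_one (by norm_num) (by norm_num) (by omega)

theorem shortLength_le_longLength (k : ℕ) : shortLength k ≤ longLength k :=
  pow_le_of_le_one (longLength_pos k).le ((longLength_le k).trans (by norm_num)) two_ne_zero

theorem longLength_succ (k : ℕ) : longLength (k + 1) = longLength k / 10 ^ 6 := by
  rw [longLength, pow_succ, longLength]; ring

/-- With `k + 1 ≤ 2 ^ (k + 1)`, the geometric decay of the lengths absorbs the number of labels on a
sphere. -/
theorem add_mul_longLength_le (k : ℕ) : (k + 1) * longLength k ≤ 1 / 10 ^ 5 := by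
  have h : ((k + 1 : ℕ) : ℝ) ≤ 2 ^ (k + 1) := by exact_mod_cast (Nat.lt_two_pow_self).le
  push_cast at h
  calc (k + 1) * longLength k ≤ 2 ^ (k + 1) * longLength k :=
        mul_le_mul_of_nonneg_right h (longLength_pos k).le
    _ = (2 / 10 ^ 6) ^ (k + 1) := by rw [longLength, ← mul_pow]; norm_num
    _ ≤ 2 / 10 ^ 6 := pow_le_of_le_one (by norm_num) (by norm_num) (by omega)
    _ ≤ 1 / 10 ^ 5 := by norm_num

/-- The length of an edge of level `k` joining vertices with labels `i`, `j`. -/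
def levelLength (cls : ℕ → ℕ) (k i j : ℕ) : ℝ :=
  if cls i = cls j then shortLength k else longLength k

theorem levelLength_pos (cls : ℕ → ℕ) (k i j : ℕ) : 0 < levelLength cls k i j := by
  unfold levelLength
  split_ifs
  exacts [shortLength_pos k, longLength_pos k]

theorem levelLength_le (cls : ℕ → ℕ) (k i j : ℕ) : levelLength cls k i j ≤ longLength k := by
  unfold levelLength
  split_ifs
  exacts [shortLength_le_longLength k, le_rfl]

theorem levelLength_le_eighth (cls : ℕ → ℕ) (k i j : ℕ) : levelLength cls k i j ≤ 1 / 8 :=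
  (levelLength_le cls k i j).trans ((longLength_le k).trans (by norm_num))

/-- The antitree with sphere numbers `n + 1`. -/
abbrev linearAntitree : SimpleGraph (Σ n, Fin (n + 1)) := antitree (fun n => n + 1)

/-- The edge lengths determined by a classification of the labels. -/
def classLength (cls : ℕ → ℕ) (e : linearAntitree.edgeSet) : ℝ :=
  Sym2.lift ⟨fun v w : (Σ n, Fin (n + 1)) => levelLength cls (max v.1 w.1) v.2 w.2, fun v w => by
    simp only [levelLength, max_comm, eq_comm]⟩ e.1

theorem classLength_starEdge (cls : ℕ → ℕ) (v : Σ n, Fin (n + 1))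
    (w : linearAntitree.neighborSet v) :
    classLength cls (starEdge v w) = levelLength cls (max v.1 w.1.1) v.2 w.1.2 := rfl

theorem classLength_eq (cls : ℕ → ℕ) (o : Orientation linearAntitree)
    (e : linearAntitree.edgeSet) :
    classLength cls e =
      levelLength cls (max (o.tail e).1 (o.head e).1) (o.tail e).2 (o.head e).2 := by
  rw [classLength, ← o.mk_eq e]
  rfl

theorem classLength_pos (cls : ℕ → ℕ) (e : linearAntitree.edgeSet) : 0 < classLength cls e := by
  rw [classLength_eq cls (Classical.arbitrary _) e]
  exact levelLength_pos _ _ _ _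

theorem classLength_le_eighth (cls : ℕ → ℕ) (e : linearAntitree.edgeSet) :
    classLength cls e ≤ 1 / 8 := by
  rw [classLength_eq cls (Classical.arbitrary _) e]
  exact levelLength_le_eighth _ _ _ _

/-! ### The neighbours of a vertex -/

/-- The vertex with label `j` in the `n`-th sphere. -/
def vtx (n j : ℕ) : Σ n, Fin (n + 1) := ⟨n, Fin.ofNat (n + 1) j⟩

theorem vtx_val (n : ℕ) (i : Fin (n + 1)) : vtx n i = ⟨n, i⟩ := by
  simp [vtx]

theorem vtx_snd {n j : ℕ} (h : j < n + 1) : ((vtx n j).2 : ℕ) = j := by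
  simp [vtx, Nat.mod_eq_of_lt h]

theorem sum_fin_eq_sum_vtx (φ : (Σ n, Fin (n + 1)) → ℂ) (n : ℕ) :
    ∑ j : Fin (n + 1), φ ⟨n, j⟩ = ∑ j ∈ Finset.range (n + 1), φ (vtx n j) := by
  rw [← Fin.sum_univ_eq_sum_range (fun j => φ (vtx n j))]
  exact Finset.sum_congr rfl fun j _ => by rw [vtx_val]

/-- The spheres `n + 1` and `n - 1` have `n + 2` and `n` vertices. For `n = 0` the truncated index
`n - 1` is harmless because the second range is empty. -/
theorem sum_neighborSet (φ : (Σ n, Fin (n + 1)) → ℂ) (n : ℕ) (i : Fin (n + 1)) :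
    ∑ w : linearAntitree.neighborSet ⟨n, i⟩, φ w =
      ∑ j ∈ Finset.range (n + 2), φ (vtx (n + 1) j) + ∑ j ∈ Finset.range n, φ (vtx (n - 1) j) := by
  classical
  cases n with
  | zero =>
    rw [Finset.range_zero, Finset.sum_empty, add_zero, ← sum_fin_eq_sum_vtx]
    rw [← Finset.sum_subtype (p := (· ∈ linearAntitree.neighborSet ⟨0, i⟩))
      (Finset.univ.map (Function.Embedding.sigmaMk (β := fun n => Fin (n + 1)) 1)) (fun w => ?_) φ]
    · simp
    · obtain ⟨m, j⟩ := w
      simp only [Finset.mem_map, Finset.mem_univ, true_and, Function.Embedding.sigmaMk_apply,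
        SimpleGraph.mem_neighborSet, antitree]
      constructor
      · rintro ⟨j', h⟩
        obtain rfl : 1 = m := congrArg Sigma.fst h
        omega
      · intro h
        obtain rfl : m = 1 := by omega
        exact ⟨j, rfl⟩
  | succ n =>
    rw [Nat.add_sub_cancel, ← sum_fin_eq_sum_vtx, ← sum_fin_eq_sum_vtx]
    rw [← Finset.sum_subtype (p := (· ∈ linearAntitree.neighborSet ⟨n + 1, i⟩))
      ((Finset.univ.map (Function.Embedding.sigmaMk (β := fun n => Fin (n + 1)) (n + 2))) ∪
        Finset.univ.map (Function.Embedding.sigmaMk (β := fun n => Fin (n + 1)) n))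
      (fun w => ?_) φ]
    · rw [Finset.sum_union]
      · simp
      · rw [Finset.disjoint_left]
        rintro w h1 h2
        simp only [Finset.mem_map, Finset.mem_univ, true_and,
          Function.Embedding.sigmaMk_apply] at h1 h2
        obtain ⟨j, rfl⟩ := h1
        obtain ⟨j', h⟩ := h2
        have := congrArg Sigma.fst h
        simp at this
    · obtain ⟨m, j⟩ := w
      simp only [Finset.mem_union, Finset.mem_map, Finset.mem_univ, true_and,
        Function.Embedding.sigmaMk_apply, SimpleGraph.mem_neighborSet, antitree]
      constructor
      · rintro (⟨j', h⟩ | ⟨j', h⟩)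
        · obtain rfl : n + 2 = m := congrArg Sigma.fst h
          omega
        · obtain rfl : n = m := congrArg Sigma.fst h
          omega
      · intro h
        rcases h with h | h
        · obtain rfl : m = n + 2 := by omega
          exact Or.inl ⟨j, rfl⟩
        · obtain rfl : m = n := by omega
          exact Or.inr ⟨j, rfl⟩

/-! ### The discrete equation in terms of spheres and labels -/

/-- The coupling `1 / S` of an edge. -/
def coupling (cls : ℕ → ℕ) (κ : ℂ) (k i j : ℕ) : ℂ := (sinSol κ (levelLength cls k i j))⁻¹

/-- The contribution `C / S` of an edge to the diagonal. -/
def potential (cls : ℕ → ℕ) (κ : ℂ) (k i j : ℕ) : ℂ :=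
  cosSol κ (levelLength cls k i j) / sinSol κ (levelLength cls k i j)

/-- The discrete equation at the vertex with label `i` in the `n`-th sphere, where `y₀`, `y₁`, `y₂`
are the values on the spheres `n - 1`, `n`, `n + 1`. -/
def SphereEquation (cls : ℕ → ℕ) (κ : ℂ) (n i : ℕ) (y₀ y₁ y₂ : ℕ → ℂ) : Prop :=
  ∑ j ∈ Finset.range (n + 2), coupling cls κ (n + 1) i j * y₂ j +
    ∑ j ∈ Finset.range n, coupling cls κ n i j * y₀ j =
  (∑ j ∈ Finset.range (n + 2), potential cls κ (n + 1) i j +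
    ∑ j ∈ Finset.range n, potential cls κ n i j) * y₁ i

theorem discreteSolution_iff (cls : ℕ → ℕ) (κ : ℂ) (x : (Σ n, Fin (n + 1)) → ℂ) :
    DiscreteSolution (classLength cls) κ x ↔
      ∀ n, ∀ i < n + 1, SphereEquation cls κ n i (fun j => x (vtx (n - 1) j))
        (fun j => x (vtx n j)) (fun j => x (vtx (n + 1) j)) := by
  have key : ∀ n (i : Fin (n + 1)),
      (∑ w : linearAntitree.neighborSet ⟨n, i⟩,
        (x w - cosSol κ (classLength cls (starEdge ⟨n, i⟩ w)) * x ⟨n, i⟩) /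
          sinSol κ (classLength cls (starEdge ⟨n, i⟩ w)) = 0) ↔
      SphereEquation cls κ n i (fun j => x (vtx (n - 1) j))
        (fun j => x (vtx n j)) (fun j => x (vtx (n + 1) j)) := by
    intro n i
    have h := sum_neighborSet (fun w => (x w - cosSol κ
      (levelLength cls (max n w.1) i w.2) * x ⟨n, i⟩) / sinSol κ (levelLength cls (max n w.1) i w.2))
      n i
    have e1 : ∀ j ∈ Finset.range (n + 2), (x (vtx (n + 1) j) - cosSol κ
        (levelLength cls (max n (vtx (n + 1) j).1) i (vtx (n + 1) j).2) * x ⟨n, i⟩) /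
          sinSol κ (levelLength cls (max n (vtx (n + 1) j).1) i (vtx (n + 1) j).2) =
        coupling cls κ (n + 1) i j * x (vtx (n + 1) j) -
          potential cls κ (n + 1) i j * x ⟨n, i⟩ := by
      intro j hj
      rw [vtx_snd (Finset.mem_range.1 hj)]
      have : max n (vtx (n + 1) j).1 = n + 1 := max_eq_right (Nat.le_succ n)
      rw [this, coupling, potential]
      ring
    have e2 : ∀ j ∈ Finset.range n, (x (vtx (n - 1) j) - cosSol κ
        (levelLength cls (max n (vtx (n - 1) j).1) i (vtx (n - 1) j).2) * x ⟨n, i⟩) /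
          sinSol κ (levelLength cls (max n (vtx (n - 1) j).1) i (vtx (n - 1) j).2) =
        coupling cls κ n i j * x (vtx (n - 1) j) - potential cls κ n i j * x ⟨n, i⟩ := by
      intro j hj
      have hj := Finset.mem_range.1 hj
      rw [vtx_snd (by omega)]
      have : max n (vtx (n - 1) j).1 = n := max_eq_left (Nat.sub_le n 1)
      rw [this, coupling, potential]
      ring
    rw [Finset.sum_congr rfl e1, Finset.sum_congr rfl e2, Finset.sum_sub_distrib,
      Finset.sum_sub_distrib, ← Finset.sum_mul, ← Finset.sum_mul] at h
    simp only [classLength_starEdge]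
    rw [h, SphereEquation, vtx_val]
    constructor <;> intro h' <;> linear_combination h'
  constructor
  · intro h n i hi
    exact (key n ⟨i, hi⟩).1 (h ⟨n, ⟨i, hi⟩⟩)
  · rintro h ⟨n, i⟩
    exact (key n i).2 (h n i i.2)

/-! ### Sums over classes -/

/-- The sum of `y` over the labels `j < m` in the class `c`. -/
def classSum (cls : ℕ → ℕ) (m c : ℕ) (y : ℕ → ℂ) : ℂ :=
  ∑ j ∈ Finset.range m with cls j = c, y j

/-- The number of labels `j < m` in the class `c`. -/
def classCard (cls : ℕ → ℕ) (m c : ℕ) : ℕ := {j ∈ Finset.range m | cls j = c}.card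

/-- The classes among the labels `j < m`. -/
def classes (cls : ℕ → ℕ) (m : ℕ) : Finset ℕ := {c ∈ Finset.range m | cls c = c}

section

variable {cls : ℕ → ℕ} {m c : ℕ}

theorem mem_classes : c ∈ classes cls m ↔ c < m ∧ cls c = c := by
  simp [classes]

theorem cls_mem_classes (hle : ∀ i, cls i ≤ i) (hid : ∀ i, cls (cls i) = cls i) {j : ℕ}
    (hj : j < m) : cls j ∈ classes cls m :=
  mem_classes.2 ⟨(hle j).trans_lt hj, hid j⟩

theorem card_classes_le (cls : ℕ → ℕ) (m : ℕ) : (classes cls m).card ≤ m :=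
  (Finset.card_filter_le _ _).trans (Finset.card_range m).le

theorem sum_classSum (hle : ∀ i, cls i ≤ i) (hid : ∀ i, cls (cls i) = cls i) (y : ℕ → ℂ) :
    ∑ c ∈ classes cls m, classSum cls m c y = ∑ j ∈ Finset.range m, y j :=
  Finset.sum_fiberwise_of_maps_to
    (fun _ hj => cls_mem_classes hle hid (Finset.mem_range.1 hj)) y

/-- A member `j` of the class `m` satisfies `m = cls j ≤ j`, so `m` itself is the first member. -/
theorem classSum_new (hle : ∀ i, cls i ≤ i) (hm : cls m = m) (y : ℕ → ℂ) :
    classSum cls (m + 1) m y = y m := by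
  rw [classSum, Finset.sum_eq_single_of_mem m (by simp [hm])]
  intro j hj hne
  simp only [Finset.mem_filter, Finset.mem_range] at hj
  have := hle j
  omega

/-- The label `m` either belongs to a class already present or opens a new one. The last term is the
free parameter of the sphere. -/
theorem sum_eq_sum_classSum_add (hle : ∀ i, cls i ≤ i) (hid : ∀ i, cls (cls i) = cls i)
    (y : ℕ → ℂ) :
    ∑ j ∈ Finset.range (m + 1), y j =
      ∑ c ∈ classes cls m, classSum cls (m + 1) c y + if cls m = m then y m else 0 := by
  rw [← sum_classSum hle hid]
  by_cases hm : cls m = m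
  · have : classes cls (m + 1) = insert m (classes cls m) := by
      rw [classes, Finset.range_add_one, Finset.filter_insert, if_pos hm, classes]
    rw [this, Finset.sum_insert (by simp [mem_classes]), classSum_new hle hm, if_pos hm, add_comm]
  · have : classes cls (m + 1) = classes cls m := by
      rw [classes, Finset.range_add_one, Finset.filter_insert, if_neg hm, classes]
    rw [this, if_neg hm, add_zero]

theorem classSum_of_const {y : ℕ → ℂ} {a : ℂ} (h : ∀ j < m, cls j = c → y j = a) :
    classSum cls m c y = classCard cls m c * a := by
  rw [classSum, Finset.sum_congr rfl (g := fun _ => a), Finset.sum_const, nsmul_eq_mul, classCard]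
  intro j hj
  simp only [Finset.mem_filter, Finset.mem_range] at hj
  exact h j hj.1 hj.2

theorem one_le_classCard (h : c ∈ classes cls m) : 1 ≤ classCard cls m c := by
  rw [Nat.one_le_iff_ne_zero, classCard, Finset.card_ne_zero]
  rw [mem_classes] at h
  exact ⟨c, by simp [h.1, h.2]⟩

theorem classCard_mono {m' : ℕ} (h : m ≤ m') (c : ℕ) : classCard cls m c ≤ classCard cls m' c :=
  Finset.card_le_card (Finset.filter_subset_filter _ (Finset.range_mono h))

theorem sum_classCard_le (hle : ∀ i, cls i ≤ i) (hid : ∀ i, cls (cls i) = cls i) {m' : ℕ}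
    (h : m' ≤ m) : ∑ c ∈ classes cls m', classCard cls m c ≤ m := by
  calc ∑ c ∈ classes cls m', classCard cls m c ≤ ∑ c ∈ classes cls m, classCard cls m c :=
        Finset.sum_le_sum_of_subset (Finset.filter_subset_filter _ (Finset.range_mono h))
    _ = (Finset.range m).card := (Finset.card_eq_sum_card_fiberwise
        fun _ hj => cls_mem_classes hle hid (Finset.mem_range.1 hj)).symm
    _ = m := Finset.card_range m

theorem sum_ite_le (cls : ℕ → ℕ) (m c : ℕ) (a b : ℝ) :
    ∑ j ∈ Finset.range m, ((if c = cls j then a else 0) + b) = classCard cls m c * a + m * b := by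
  rw [Finset.sum_add_distrib, ← Finset.sum_filter]
  simp [classCard, eq_comm]

end

/-! ### The system of equations on a sphere -/

section

variable {cls : ℕ → ℕ} {m : ℕ} {r : ℂ}

/-- For `K` classes, the class system has matrix `(1 - r) I + r J`, with `J` the all-ones matrix;
its eigenvalues are among `1 - r` and `1 - r + K r`. Since `K ≤ m`, both stay close to `1`. -/
theorem small_perturbation (hr : ‖r‖ * (m + 1) ≤ 1 / 1000) :
    99 / 100 ≤ ‖1 - r‖ ∧ 99 / 100 ≤ ‖1 - r + (classes cls m).card * r‖ := by
  have hm : (0 : ℝ) ≤ m := m.cast_nonneg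
  have h0 := norm_nonneg r
  have hK : ((classes cls m).card : ℝ) ≤ m := by exact_mod_cast card_classes_le cls m
  have e1 : ‖r‖ ≤ 1 / 1000 := by nlinarith
  constructor
  · have := norm_sub_norm_le (1 : ℂ) r
    rw [norm_one] at this
    linarith
  · have h1 := norm_sub_norm_le (1 : ℂ) (r - (classes cls m).card * r)
    have h2 := norm_sub_le r ((classes cls m).card * r)
    rw [norm_one] at h1
    rw [norm_mul, Complex.norm_natCast] at h2
    rw [sub_sub_eq_add_sub, add_sub_right_comm] at h1
    nlinarith

/-- Uniqueness for the system of equations on a sphere. -/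
theorem eq_zero_of_classSum (hle : ∀ i, cls i ≤ i) (hid : ∀ i, cls (cls i) = cls i)
    (hr : ‖r‖ * (m + 1) ≤ 1 / 1000) {y : ℕ → ℂ}
    (hy : ∀ i < m + 1, ∀ j < m + 1, cls i = cls j → y i = y j)
    (heq : ∀ c ∈ classes cls m,
      (1 - r) * classSum cls (m + 1) c y + r * ∑ j ∈ Finset.range (m + 1), y j = 0)
    (hp : cls m = m → y m = 0) : ∀ i < m + 1, y i = 0 := by
  obtain ⟨h1, h2⟩ := small_perturbation (cls := cls) hr
  have h1' : 1 - r ≠ 0 := norm_pos_iff.1 (by linarith)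
  have h2' : 1 - r + (classes cls m).card * r ≠ 0 := norm_pos_iff.1 (by linarith)
  have hT := sum_eq_sum_classSum_add (m := m) hle hid y
  rw [show (if cls m = m then y m else 0) = 0 by simpa using hp, add_zero] at hT
  set T := ∑ j ∈ Finset.range (m + 1), y j with hTdef
  -- Adding the equations over all classes gives a scalar equation for the total sum `T`; once `T =
  -- 0`, they decouple.
  have hsum := Finset.sum_congr rfl heq
  rw [Finset.sum_add_distrib, ← Finset.mul_sum, ← hT, Finset.sum_const, Finset.sum_const_zero,
    nsmul_eq_mul] at hsum
  have hT0 : T = 0 := by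
    refine (mul_eq_zero.1 (?_ : (1 - r + (classes cls m).card * r) * T = 0)).resolve_left h2'
    linear_combination hsum
  intro i hi
  by_cases hc : cls i < m
  · have hmem : cls i ∈ classes cls m := mem_classes.2 ⟨hc, hid i⟩
    have h := heq _ hmem
    rw [hT0, mul_zero, add_zero, classSum_of_const fun j hj hji => hy j hj i hi hji] at h
    have hcard : (classCard cls (m + 1) (cls i) : ℂ) ≠ 0 := by
      have := one_le_classCard (cls_mem_classes hle hid hi)
      exact_mod_cast (by omega : classCard cls (m + 1) (cls i) ≠ 0)
    simpa [h1', hcard] using h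
  · have := hle i
    obtain rfl : i = m := by omega
    exact hp (by omega)

/-- The solution of the system of equations on a sphere, as a function of the class. -/
def sphereSolution (cls : ℕ → ℕ) (m : ℕ) (r : ℂ) (g : ℕ → ℂ) (p : ℂ) (c : ℕ) : ℂ :=
  if c < m then
    (g c - r * ((∑ c ∈ classes cls m, g c + (1 - r) * if cls m = m then p else 0) /
      (1 - r + (classes cls m).card * r))) / (1 - r) / classCard cls (m + 1) c
  else p

theorem sphereSolution_eq (hle : ∀ i, cls i ≤ i) (hid : ∀ i, cls (cls i) = cls i)
    (hr : ‖r‖ * (m + 1) ≤ 1 / 1000) (g : ℕ → ℂ) (p : ℂ) {c : ℕ} (hc : c ∈ classes cls m) :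
    (1 - r) * classSum cls (m + 1) c (fun j => sphereSolution cls m r g p (cls j)) +
      r * ∑ j ∈ Finset.range (m + 1), sphereSolution cls m r g p (cls j) = g c := by
  obtain ⟨h1, h2⟩ := small_perturbation (cls := cls) hr
  have h1' : 1 - r ≠ 0 := norm_pos_iff.1 (by linarith)
  have h2' : 1 - r + (classes cls m).card * r ≠ 0 := norm_pos_iff.1 (by linarith)
  -- This is the total sum over the sphere, found by adding the equations over the classes with the
  -- new parameter `p` given.
  set T := (∑ c ∈ classes cls m, g c + (1 - r) * if cls m = m then p else 0) /
      (1 - r + (classes cls m).card * r) with hT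
  have hF : ∀ c ∈ classes cls m,
      classSum cls (m + 1) c (fun j => sphereSolution cls m r g p (cls j)) =
        (g c - r * T) / (1 - r) := by
    intro c hc
    have hcm := mem_classes.1 hc
    have hcard : (classCard cls (m + 1) c : ℂ) ≠ 0 := by
      have := one_le_classCard (m := m + 1) (mem_classes.2 ⟨by omega, hcm.2⟩)
      exact_mod_cast (by omega : classCard cls (m + 1) c ≠ 0)
    rw [classSum_of_const (a := sphereSolution cls m r g p c) fun j _ hj => by rw [hj],
      sphereSolution, if_pos hcm.1, ← hT]
    field_simp
  have hsum : ∑ j ∈ Finset.range (m + 1), sphereSolution cls m r g p (cls j) = T := by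
    rw [sum_eq_sum_classSum_add hle hid, Finset.sum_congr rfl hF, ← Finset.sum_div,
      Finset.sum_sub_distrib, Finset.sum_const, nsmul_eq_mul]
    have : (if cls m = m then sphereSolution cls m r g p (cls m) else 0) =
        if cls m = m then p else 0 := by
      split_ifs with h
      · rw [h, sphereSolution, if_neg (lt_irrefl m)]
      · rfl
    rw [this]
    have hT' : T * (1 - r + (classes cls m).card * r) =
        ∑ c ∈ classes cls m, g c + (1 - r) * if cls m = m then p else 0 :=
      div_mul_cancel₀ _ h2'
    field_simp
    linear_combination -hT'
  rw [hsum, hF c hc]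
  field_simp
  ring

/-- The growth factor is independent of `m`: the data are proportional to the class size by which
the solution divides, and `T`, of order `m + 1`, enters only through `r * T`. The outcome is at most
`41 / 0.99` times `M`. -/
theorem norm_sphereSolution_le (hle : ∀ i, cls i ≤ i) (hid : ∀ i, cls (cls i) = cls i)
    (hr : ‖r‖ * (m + 1) ≤ 1 / 1000) {g : ℕ → ℂ} {p : ℂ} {M : ℝ}
    (hg : ∀ c ∈ classes cls m, ‖g c‖ ≤ 40 * classCard cls (m + 1) c * M) (hp : ‖p‖ ≤ M)
    {c : ℕ} (hc : cls c = c) : ‖sphereSolution cls m r g p c‖ ≤ 100 * M := by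
  have hM : 0 ≤ M := (norm_nonneg p).trans hp
  obtain ⟨h1, h2⟩ := small_perturbation (cls := cls) hr
  rw [sphereSolution]
  by_cases hcm : c < m
  swap
  · rw [if_neg hcm]
    linarith
  rw [if_pos hcm]
  set T := (∑ c ∈ classes cls m, g c + (1 - r) * if cls m = m then p else 0) /
      (1 - r + (classes cls m).card * r) with hT
  have hm : (0 : ℝ) ≤ m := m.cast_nonneg
  have h0 := norm_nonneg r
  have hr1 : ‖r‖ ≤ 1 / 1000 := by nlinarith
  have hcard : (1 : ℝ) ≤ classCard cls (m + 1) c := by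
    exact_mod_cast one_le_classCard (mem_classes.2 ⟨Nat.lt_succ_of_lt hcm, hc⟩)
  have hS : ‖∑ c ∈ classes cls m, g c‖ ≤ 40 * (m + 1) * M := by
    refine (norm_sum_le _ _).trans ((Finset.sum_le_sum hg).trans ?_)
    rw [← Finset.sum_mul, ← Finset.mul_sum]
    have : (∑ c ∈ classes cls m, (classCard cls (m + 1) c : ℝ)) ≤ m + 1 := by
      exact_mod_cast sum_classCard_le hle hid (Nat.le_succ m)
    gcongr
  have h1r : ‖1 - r‖ ≤ 2 := by
    have := norm_sub_le (1 : ℂ) r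
    rw [norm_one] at this
    linarith
  have hP : ‖(1 - r) * if cls m = m then p else 0‖ ≤ 2 * M := by
    rw [norm_mul]
    gcongr
    split_ifs
    · exact hp
    · rwa [norm_zero]
  have hTn : ‖T‖ ≤ 50 * (m + 1) * M := by
    rw [hT, norm_div, div_le_iff₀ (by linarith)]
    refine (norm_add_le _ _).trans ((add_le_add hS hP).trans ?_)
    nlinarith [mul_nonneg hm hM]
  have hrT : ‖r * T‖ ≤ M := by
    rw [norm_mul]
    calc ‖r‖ * ‖T‖ ≤ ‖r‖ * (50 * (m + 1) * M) := by gcongr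
      _ = ‖r‖ * (m + 1) * (50 * M) := by ring
      _ ≤ 1 / 1000 * (50 * M) := by gcongr
      _ ≤ M := by linarith
  rw [norm_div, norm_div, Complex.norm_natCast, div_div, div_le_iff₀ (by nlinarith)]
  have h3 := norm_sub_le (g c) (r * T)
  have h4 := hg c (mem_classes.2 ⟨hcm, hc⟩)
  have h5 : 99 / 100 * classCard cls (m + 1) c ≤ ‖1 - r‖ * classCard cls (m + 1) c := by gcongr
  have h6 : M ≤ classCard cls (m + 1) c * M := le_mul_of_one_le_left hM hcard
  nlinarith

end

/-! ### Solving the discrete equation sphere by sphere -/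

section

variable {cls : ℕ → ℕ} {κ : ℂ}

/-- The ratio of the couplings between different classes and inside a class. -/
def couplingRatio (κ : ℂ) (k : ℕ) : ℂ := sinSol κ (shortLength k) / sinSol κ (longLength k)

theorem shortLength_le_eighth (k : ℕ) : shortLength k ≤ 1 / 8 :=
  (shortLength_le_longLength k).trans ((longLength_le k).trans (by norm_num))

theorem longLength_le_eighth (k : ℕ) : longLength k ≤ 1 / 8 :=
  (longLength_le k).trans (by norm_num)

/-- Short lengths are squares of long ones, so the ratio is at most `3 * longLength k`, which is
small even after multiplication by `k + 1`. -/
theorem norm_couplingRatio_le (hκ : ‖κ‖ = 1) (k : ℕ) :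
    ‖couplingRatio κ k‖ * (k + 1) ≤ 1 / 1000 := by
  have h1 := norm_sinSol_le hκ (shortLength_pos k).le (shortLength_le_eighth k)
  have h2 := norm_inv_sinSol_le hκ (longLength_pos k) (longLength_le_eighth k)
  have h3 := add_mul_longLength_le k
  have hL := longLength_pos k
  rw [couplingRatio, div_eq_mul_inv, norm_mul]
  calc ‖sinSol κ (shortLength k)‖ * ‖(sinSol κ (longLength k))⁻¹‖ * (k + 1)
      ≤ 3 / 2 * shortLength k * (2 / longLength k) * (k + 1) := by
        have := shortLength_pos k
        gcongr
    _ = 3 * ((k + 1) * longLength k) := by rw [shortLength]; field_simp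
    _ ≤ 1 / 1000 := by linarith

theorem coupling_congr {i i' : ℕ} (h : cls i = cls i') (k j : ℕ) :
    coupling cls κ k i j = coupling cls κ k i' j := by
  rw [coupling, coupling, levelLength, levelLength, h]

theorem potential_congr {i i' : ℕ} (h : cls i = cls i') (k j : ℕ) :
    potential cls κ k i j = potential cls κ k i' j := by
  rw [potential, potential, levelLength, levelLength, h]

/-- Splitting the coupling into an all-to-all part and an excess inside the class is what turns the
equations into a system for class sums and the total sum. -/
theorem coupling_eq (hκ : ‖κ‖ = 1) (k i j : ℕ) : coupling cls κ k i j =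
    (sinSol κ (shortLength k))⁻¹ *
      ((if cls j = cls i then 1 - couplingRatio κ k else 0) + couplingRatio κ k) := by
  have h1 := sinSol_ne_zero hκ (shortLength_pos k) (shortLength_le_eighth k)
  have h2 := sinSol_ne_zero hκ (longLength_pos k) (longLength_le_eighth k)
  rw [coupling, levelLength, couplingRatio]
  by_cases h : cls i = cls j
  · rw [if_pos h, if_pos h.symm]; ring
  · rw [if_neg h, if_neg (Ne.symm h)]; field_simp; ring

theorem sum_coupling_mul (hκ : ‖κ‖ = 1) (k i m : ℕ) (y : ℕ → ℂ) :
    ∑ j ∈ Finset.range m, coupling cls κ k i j * y j = (sinSol κ (shortLength k))⁻¹ *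
      ((1 - couplingRatio κ k) * classSum cls m (cls i) y +
        couplingRatio κ k * ∑ j ∈ Finset.range m, y j) := by
  rw [classSum, Finset.sum_filter, Finset.mul_sum, Finset.mul_sum, ← Finset.sum_add_distrib,
    Finset.mul_sum]
  refine Finset.sum_congr rfl fun j _ => ?_
  rw [coupling_eq hκ]
  split_ifs <;> ring

/-- All summands have positive real part. This allows the value at a vertex to be recovered from its
equation. -/
theorem sum_potential_ne_zero (hκ : ‖κ‖ = 1) (n i : ℕ) :
    ∑ j ∈ Finset.range (n + 2), potential cls κ (n + 1) i j +
      ∑ j ∈ Finset.range n, potential cls κ n i j ≠ 0 := by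
  have hpos : ∀ k j, 0 < (potential cls κ k i j).re := fun k j =>
    re_cosSol_div_sinSol_pos hκ (levelLength_pos _ _ _ _) (levelLength_le_eighth _ _ _ _)
  intro h
  have h' := congrArg Complex.re h
  rw [Complex.add_re, Complex.re_sum, Complex.re_sum, Complex.zero_re] at h'
  have h1 : 0 < ∑ j ∈ Finset.range (n + 2), (potential cls κ (n + 1) i j).re :=
    Finset.sum_pos (fun j _ => hpos _ j) ⟨0, by simp⟩
  have h2 : 0 ≤ ∑ j ∈ Finset.range n, (potential cls κ n i j).re :=
    Finset.sum_nonneg fun j _ => (hpos _ j).le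
  linarith

/-- A solution of the discrete equation is determined by its values at the class
representatives. -/
theorem DiscreteSolution.eq_zero (hle : ∀ i, cls i ≤ i) (hid : ∀ i, cls (cls i) = cls i)
    (hκ : ‖κ‖ = 1) {x : (Σ n, Fin (n + 1)) → ℂ} (hx : DiscreteSolution (classLength cls) κ x)
    (h0 : ∀ j, cls j = j → x (vtx j j) = 0) : x = 0 := by
  rw [discreteSolution_iff] at hx
  -- Labels of one class have identical coefficients, so their equations differ only in the value
  -- multiplied by the nonzero diagonal.
  have hconst : ∀ n, ∀ i < n + 1, ∀ j < n + 1, cls i = cls j → x (vtx n i) = x (vtx n j) := by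
    intro n i hi j hj hij
    have h1 := hx n i hi
    have h2 := hx n j hj
    simp only [SphereEquation, coupling_congr hij, potential_congr hij] at h1 h2
    exact mul_left_cancel₀ (sum_potential_ne_zero hκ n j) (h1.symm.trans h2)
  -- The recursion has second order, so the induction carries two consecutive spheres; the second
  -- condition is vacuous at `n = 0`.
  have hz : ∀ n, (∀ i < n + 1, x (vtx n i) = 0) ∧ ∀ i < n, x (vtx (n - 1) i) = 0 := by
    intro n
    induction n with
    | zero =>
      refine ⟨fun i hi => ?_, fun i hi => absurd hi (Nat.not_lt_zero i)⟩
      obtain rfl : i = 0 := by omega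
      exact h0 0 (Nat.le_zero.1 (hle 0))
    | succ n ih =>
      refine ⟨?_, ih.1⟩
      refine eq_zero_of_classSum (m := n + 1) (r := couplingRatio κ (n + 1)) hle hid
        (by exact_mod_cast norm_couplingRatio_le hκ (n + 1)) (hconst (n + 1)) ?_ (h0 (n + 1))
      intro c hc
      rw [mem_classes] at hc
      have h := hx n c hc.1
      rw [SphereEquation, ih.1 c hc.1, mul_zero,
        Finset.sum_eq_zero (s := Finset.range n) fun j hj => by
          rw [ih.2 j (Finset.mem_range.1 hj), mul_zero],
        add_zero, sum_coupling_mul hκ, hc.2] at h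
      exact (mul_eq_zero.1 h).resolve_left
        (inv_ne_zero (sinSol_ne_zero hκ (shortLength_pos _) (shortLength_le_eighth _)))
  funext v
  obtain ⟨n, i⟩ := v
  rw [← vtx_val]
  exact (hz n).1 i i.2

/-! ### Existence and growth of solutions -/

/-- The right-hand side of the equations for the values on the sphere `n + 1`, given the values on
the spheres `n - 1` and `n`. -/
def sphereData (cls : ℕ → ℕ) (κ : ℂ) (n : ℕ) (y₀ y₁ : ℕ → ℂ) (c : ℕ) : ℂ :=
  sinSol κ (shortLength (n + 1)) *
    ((∑ j ∈ Finset.range (n + 2), potential cls κ (n + 1) c j +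
      ∑ j ∈ Finset.range n, potential cls κ n c j) * y₁ c -
      ∑ j ∈ Finset.range n, coupling cls κ n c j * y₀ (cls j))

theorem norm_coupling_le (hκ : ‖κ‖ = 1) (k i j : ℕ) : ‖coupling cls κ k i j‖ ≤
    (if cls i = cls j then 2 / shortLength k else 0) + 2 / longLength k := by
  have h := norm_inv_sinSol_le hκ (levelLength_pos cls k i j) (levelLength_le_eighth cls k i j)
  have hL := longLength_pos k
  rw [coupling]
  refine h.trans ?_
  rw [levelLength]
  split_ifs
  · have : 0 ≤ 2 / longLength k := by positivity
    linarith
  · rw [zero_add]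

theorem norm_potential_le (hκ : ‖κ‖ = 1) (k i j : ℕ) : ‖potential cls κ k i j‖ ≤
    (if cls i = cls j then 3 / shortLength k else 0) + 3 / longLength k := by
  have h := norm_cosSol_div_sinSol_le hκ (levelLength_pos cls k i j)
    (levelLength_le_eighth cls k i j)
  have hL := longLength_pos k
  rw [potential]
  refine h.trans ?_
  rw [levelLength]
  split_ifs
  · have : 0 ≤ 3 / longLength k := by positivity
    linarith
  · rw [zero_add]

/-- The prefactor is of order `L²`. It cancels the `L⁻²` of the edges inside the class, leaving a
multiple of the class size; the other edges contribute terms with `(n + 2) L ≤ 1`, and the previous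
level brings powers of `L / L' ≤ 1`. -/
theorem norm_sphereData_le (hid : ∀ i, cls (cls i) = cls i)
    (hκ : ‖κ‖ = 1) {n : ℕ} {y₀ y₁ : ℕ → ℂ} {M : ℝ} (h₀ : ∀ c, cls c = c → ‖y₀ c‖ ≤ M)
    (h₁ : ∀ c, cls c = c → ‖y₁ c‖ ≤ M) {c : ℕ} (hc : c ∈ classes cls (n + 1)) :
    ‖sphereData cls κ n y₀ y₁ c‖ ≤ 40 * classCard cls (n + 2) c * M := by
  have hcc := mem_classes.1 hc
  have hM : 0 ≤ M := (norm_nonneg _).trans (h₀ c hcc.2)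
  set L := longLength (n + 1) with hLdef
  set L' := longLength n with hL'def
  have hL : 0 < L := longLength_pos _
  have hL' : 0 < L' := longLength_pos _
  have hLL' : L = L' / 10 ^ 6 := longLength_succ n
  set q : ℝ := ((classCard cls (n + 2) c : ℕ) : ℝ) with hq
  set q' : ℝ := ((classCard cls n c : ℕ) : ℝ) with hq'
  have hq1 : 1 ≤ q := by
    rw [hq]
    exact_mod_cast one_le_classCard (m := n + 2) (mem_classes.2 ⟨by omega, hcc.2⟩)
  have hqq' : q' ≤ q := Nat.cast_le.2 (classCard_mono (by omega) c)
  have hq'0 : 0 ≤ q' := Nat.cast_nonneg _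
  have b1 : ‖∑ j ∈ Finset.range (n + 2), potential cls κ (n + 1) c j‖ ≤
      q * (3 / L ^ 2) + (n + 2) * (3 / L) := by
    refine (norm_sum_le_of_le _ fun j _ => norm_potential_le hκ (n + 1) c j).trans ?_
    rw [hcc.2, sum_ite_le]
    push_cast
    rfl
  have b2 : ‖∑ j ∈ Finset.range n, potential cls κ n c j‖ ≤ q' * (3 / L' ^ 2) + n * (3 / L') := by
    refine (norm_sum_le_of_le _ fun j _ => norm_potential_le hκ n c j).trans ?_
    rw [hcc.2, sum_ite_le]
    rfl
  have b3 : ‖∑ j ∈ Finset.range n, coupling cls κ n c j * y₀ (cls j)‖ ≤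
      (q' * (2 / L' ^ 2) + n * (2 / L')) * M := by
    refine (norm_sum_le_of_le (n := fun j => ((if c = cls j then 2 / L' ^ 2 else 0) + 2 / L') * M)
      _ fun j _ => ?_).trans ?_
    · rw [norm_mul]
      have := norm_coupling_le (cls := cls) hκ n c j
      rw [hcc.2] at this
      refine mul_le_mul this (h₀ _ (hid j)) (norm_nonneg _) ((norm_nonneg _).trans this)
    · rw [← Finset.sum_mul, sum_ite_le]
  have b0 : ‖sinSol κ (shortLength (n + 1))‖ ≤ 3 / 2 * L ^ 2 :=
    norm_sinSol_le hκ (shortLength_pos _).le (shortLength_le_eighth _)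
  have hnL : (n + 2) * L ≤ 1 := by
    have := add_mul_longLength_le (n + 1)
    push_cast at this
    rw [← hLdef] at this
    linarith
  have hn0 : (0 : ℝ) ≤ n := n.cast_nonneg
  have hy := h₁ c hcc.2
  rw [sphereData, norm_mul]
  calc ‖sinSol κ (shortLength (n + 1))‖ * _
      ≤ 3 / 2 * L ^ 2 * ((q * (3 / L ^ 2) + (n + 2) * (3 / L) +
          (q' * (3 / L' ^ 2) + n * (3 / L'))) * M +
          (q' * (2 / L' ^ 2) + n * (2 / L')) * M) := by
        refine mul_le_mul b0 ?_ (norm_nonneg _) (by positivity)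
        refine (norm_sub_le _ _).trans (add_le_add ?_ b3)
        rw [norm_mul]
        exact mul_le_mul ((norm_add_le _ _).trans (add_le_add b1 b2)) hy (norm_nonneg _)
          (by positivity)
    _ = 3 / 2 * (3 * q + 3 * ((n + 2) * L) + 5 * q' * (L / L') ^ 2 + 5 * (n * L) * (L / L')) * M := by
        field_simp
        ring
    _ ≤ 3 / 2 * (3 * q + 3 * 1 + 5 * q * 1 ^ 2 + 5 * 1 * 1) * M := by
        have h1 : L / L' ≤ 1 := by rw [div_le_one hL', hLL']; linarith
        have h2 : n * L ≤ 1 := by nlinarith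
        gcongr
    _ ≤ 40 * q * M := by
        have : M ≤ q * M := le_mul_of_one_le_left hM hq1
        nlinarith

/-- The values on the spheres `n - 1` and `n`, as functions of the class, of the solution of the
discrete equation with the values `p` at the class representatives. -/
def sphereValues (cls : ℕ → ℕ) (κ : ℂ) (p : ℕ → ℂ) : ℕ → (ℕ → ℂ) × (ℕ → ℂ)
  | 0 => (fun _ => 0, fun _ => p 0)
  | n + 1 => ((sphereValues cls κ p n).2,
      sphereSolution cls (n + 1) (couplingRatio κ (n + 1))
        (sphereData cls κ n (sphereValues cls κ p n).1 (sphereValues cls κ p n).2) (p (n + 1)))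

/-- Each sphere costs the factor `100` of `norm_sphereSolution_le`; a parameter entering later is
bounded by `B ≤ B * 100 ^ n` and is absorbed. -/
theorem norm_sphereValues_le (hle : ∀ i, cls i ≤ i) (hid : ∀ i, cls (cls i) = cls i)
    (hκ : ‖κ‖ = 1) {p : ℕ → ℂ} {B : ℝ} (hp : ∀ j, ‖p j‖ ≤ B) (n : ℕ) :
    ∀ c, cls c = c → ‖(sphereValues cls κ p n).1 c‖ ≤ B * 100 ^ n ∧
      ‖(sphereValues cls κ p n).2 c‖ ≤ B * 100 ^ n := by
  have hB : 0 ≤ B := (norm_nonneg _).trans (hp 0)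
  induction n with
  | zero => intro c _; simpa [sphereValues, hB] using hp 0
  | succ n ih =>
    intro c hc
    have hpow : B ≤ B * 100 ^ n := le_mul_of_one_le_right hB (one_le_pow₀ (by norm_num))
    refine ⟨(ih c hc).2.trans ?_, ?_⟩
    · rw [pow_succ]
      linarith
    · have h := norm_sphereSolution_le (m := n + 1) (r := couplingRatio κ (n + 1)) (M := B * 100 ^ n)
        hle hid
        (by exact_mod_cast norm_couplingRatio_le hκ (n + 1))
        (fun c hc => norm_sphereData_le hid hκ (fun c hc => (ih c hc).1)
          (fun c hc => (ih c hc).2) hc) ((hp (n + 1)).trans hpow) hc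
      refine h.trans (le_of_eq ?_)
      ring

/-- There is a solution of the discrete equation with prescribed bounded values at the class
representatives, and it grows at most exponentially. -/
theorem exists_discreteSolution (hle : ∀ i, cls i ≤ i) (hid : ∀ i, cls (cls i) = cls i)
    (hκ : ‖κ‖ = 1) {p : ℕ → ℂ} {B : ℝ} (hp : ∀ j, ‖p j‖ ≤ B) :
    ∃ x : (Σ n, Fin (n + 1)) → ℂ, DiscreteSolution (classLength cls) κ x ∧
      (∀ j, cls j = j → x (vtx j j) = p j) ∧ ∀ v, ‖x v‖ ≤ B * 100 ^ v.1 := by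
  set x : (Σ n, Fin (n + 1)) → ℂ := fun v => (sphereValues cls κ p v.1).2 (cls v.2) with hx
  have hxv : ∀ n, ∀ j < n + 1, x (vtx n j) = (sphereValues cls κ p n).2 (cls j) := by
    intro n j hj
    rw [hx]
    simp only [vtx_snd hj]
    rfl
  refine ⟨x, ?_, ?_, fun v => (norm_sphereValues_le hle hid hκ hp v.1 _ (hid _)).2⟩
  · rw [discreteSolution_iff]
    intro n i hi
    have hS := sinSol_ne_zero hκ (shortLength_pos (n + 1)) (shortLength_le_eighth (n + 1))
    have heq := sphereSolution_eq (m := n + 1) (r := couplingRatio κ (n + 1)) hle hid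
      (by exact_mod_cast norm_couplingRatio_le hκ (n + 1))
      (sphereData cls κ n (sphereValues cls κ p n).1 (sphereValues cls κ p n).2) (p (n + 1))
      (cls_mem_classes hle hid hi)
    have hup : ∑ j ∈ Finset.range (n + 2), coupling cls κ (n + 1) i j * x (vtx (n + 1) j) =
        ∑ j ∈ Finset.range (n + 2), coupling cls κ (n + 1) i j *
          sphereSolution cls (n + 1) (couplingRatio κ (n + 1))
          (sphereData cls κ n (sphereValues cls κ p n).1 (sphereValues cls κ p n).2) (p (n + 1))
          (cls j) := by
      refine Finset.sum_congr rfl fun j hj => ?_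
      rw [hxv (n + 1) j (Finset.mem_range.1 hj)]
      rfl
    have hdown : ∑ j ∈ Finset.range n, coupling cls κ n i j * x (vtx (n - 1) j) =
        ∑ j ∈ Finset.range n, coupling cls κ n i j * (sphereValues cls κ p n).1 (cls j) := by
      refine Finset.sum_congr rfl fun j hj => ?_
      have hj := Finset.mem_range.1 hj
      -- A summand exists only for `n ≥ 1`, and then the first component of the recursion is the
      -- actual previous sphere.
      obtain ⟨k, rfl⟩ : ∃ k, n = k + 1 := ⟨n - 1, by omega⟩
      rw [hxv _ j (by omega)]
      rfl
    rw [SphereEquation, hup, hdown, hxv n i hi, sum_coupling_mul hκ, heq, sphereData,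
      inv_mul_cancel_left₀ hS]
    simp only [coupling_congr (hid i), potential_congr (hid i)]
    ring
  · intro j hj
    rw [hxv j j (Nat.lt_succ_self j), hj]
    cases j with
    | zero => rfl
    | succ n => simp [sphereValues, sphereSolution]

end

/-! ### The dimension of the space of square integrable solutions -/

section

variable {cls : ℕ → ℕ} {κ : ℂ}

theorem neighborSet_nonempty (v : Σ n, Fin (n + 1)) : Nonempty (linearAntitree.neighborSet v) :=
  ⟨⟨vtx (v.1 + 1) 0, Or.inl rfl⟩⟩

theorem summable_vertices :
    Summable fun v : (Σ n, Fin (n + 1)) => (1 / 2 : ℝ) ^ v.1 * (1 / 2 : ℝ) ^ (v.2 : ℕ) := by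
  have hs : Summable fun n : ℕ => (1 / 2 : ℝ) ^ n :=
    summable_geometric_of_lt_one (by norm_num) (by norm_num)
  have h := hs.mul_of_nonneg hs (fun n => by positivity) (fun n => by positivity)
  refine h.comp_injective (i := fun v : (Σ n, Fin (n + 1)) => (v.1, (v.2 : ℕ))) ?_
  rintro ⟨n, i⟩ ⟨m, j⟩ hij
  obtain ⟨rfl, h2⟩ := Prod.mk.inj hij
  exact congrArg _ (Fin.ext h2)

/-- An edge is determined by its ends, that is, by two sphere indices and two labels, all at most
the maximum in the exponent. This is why `1 / 16 = (1 / 2) ^ 4` suffices. -/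
theorem summable_edges (o : Orientation linearAntitree) :
    Summable fun e : linearAntitree.edgeSet => (1 / 16 : ℝ) ^ max (o.tail e).1 (o.head e).1 := by
  have h := summable_vertices.mul_of_nonneg summable_vertices (fun v => by positivity)
    (fun v => by positivity)
  have hinj : Function.Injective fun e => (o.tail e, o.head e) := by
    intro e e' h
    obtain ⟨h1, h2⟩ := Prod.mk.inj h
    exact Subtype.ext (by rw [← o.mk_eq, ← o.mk_eq, h1, h2])
  refine Summable.of_nonneg_of_le (fun e => by positivity) (fun e => ?_) (h.comp_injective hinj)
  simp only [Function.comp_apply]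
  have h1 := (o.tail e).2.2
  have h2 := (o.head e).2.2
  rw [← pow_add, ← pow_add, ← pow_add, show (1 / 16 : ℝ) = (1 / 2) ^ 4 by norm_num, ← pow_mul]
  exact pow_le_pow_of_le_one (by norm_num) (by norm_num) (by omega)

/-- Length times squared size on level `k` is at most a multiple of `10 ^ (-6 k) * 100 ^ (2 k) = 100
^ (-k)`, which is summable over the edges. -/
theorem memℓp_interpolationLp_of_le (o : Orientation linearAntitree) (hκ : ‖κ‖ = 1)
    {x : (Σ n, Fin (n + 1)) → ℂ} {B : ℝ} (hx : ∀ v, ‖x v‖ ≤ B * 100 ^ v.1) :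
    Memℓp (fun e => interpolationLp o (classLength cls) κ e x) 2 := by
  have hκ0 : κ ≠ 0 := norm_ne_zero_iff.1 (by rw [hκ]; exact one_ne_zero)
  have hB : 0 ≤ B := by simpa using (norm_nonneg _).trans (hx (vtx 0 0))
  refine memℓp_interpolationLp o (classLength_pos cls) hκ0
    -- The estimates `3 / 2 * t` above and `7 / 8 * L` below give the ratio `12 / 7 < 4`.
    (fun e => sinSol_ne_zero hκ (classLength_pos cls e) (classLength_le_eighth cls e)) (K := 4)
    (M := fun e => B * 100 ^ max (o.tail e).1 (o.head e).1) (fun e t ht => ?_) (fun e v hv => ?_) ?_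
  · have h1 := norm_sinSol_le hκ ht.1 (ht.2.trans (classLength_le_eighth cls e))
    have h2 := le_norm_sinSol hκ (classLength_pos cls e).le (classLength_le_eighth cls e)
    linarith [ht.1, ht.2]
  · refine (hx v).trans ?_
    gcongr
    · norm_num
    · rcases (o.mem_iff e v).1 hv with rfl | rfl
      · exact le_max_left _ _
      · exact le_max_right _ _
  · refine Summable.of_nonneg_of_le (fun e => mul_nonneg (classLength_pos cls e).le (sq_nonneg _))
      (fun e => ?_) ((summable_edges o).mul_left (B ^ 2))
    set k := max (o.tail e).1 (o.head e).1
    have h1 : classLength cls e ≤ (1 / 10 ^ 6) ^ k := by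
      rw [classLength_eq cls o]
      refine (levelLength_le _ _ _ _).trans ?_
      exact pow_le_pow_of_le_one (by norm_num) (by norm_num) (Nat.le_succ _)
    calc classLength cls e * (B * 100 ^ k) ^ 2 ≤ (1 / 10 ^ 6) ^ k * (B * 100 ^ k) ^ 2 := by gcongr
      _ = B ^ 2 * (1 / 100) ^ k := by
        rw [mul_pow, ← pow_mul, mul_comm k 2, pow_mul, mul_left_comm, ← mul_pow]
        norm_num
      _ ≤ B ^ 2 * (1 / 16) ^ k := by
        gcongr
        norm_num

/-- The values of a solution at the class representatives. -/
def classValues (o : Orientation linearAntitree) (cls : ℕ → ℕ) (κ : ℂ) :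
    solutionSpace o (classLength cls) κ →ₗ[ℂ] ({j | cls j = j} → ℂ) :=
  (LinearMap.pi fun j : {j | cls j = j} => LinearMap.proj (vtx j j)).comp (Submodule.subtype _)

theorem classValues_injective (o : Orientation linearAntitree) (hle : ∀ i, cls i ≤ i)
    (hid : ∀ i, cls (cls i) = cls i) (hκ : ‖κ‖ = 1) :
    Function.Injective (classValues o cls κ) := by
  rw [← LinearMap.ker_eq_bot, LinearMap.ker_eq_bot']
  intro x hx
  exact Subtype.ext (x.2.1.eq_zero hle hid hκ fun j hj => congrFun hx ⟨j, hj⟩)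

theorem exists_classValues_eq (o : Orientation linearAntitree) (hle : ∀ i, cls i ≤ i)
    (hid : ∀ i, cls (cls i) = cls i) (hκ : ‖κ‖ = 1) (j : {j | cls j = j}) :
    ∃ x, classValues o cls κ x = Pi.single j 1 := by
  obtain ⟨x, hx, hxp, hxb⟩ := exists_discreteSolution (p := Pi.single j.1 1) (B := 1) hle hid hκ
    (fun i => by
      by_cases h : i = j.1
      · subst h; simp
      · simp [Pi.single_eq_of_ne h])
  refine ⟨⟨x, hx, memℓp_interpolationLp_of_le o hκ hxb⟩, funext fun i => (hxp i i.2).trans ?_⟩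
  simp [Pi.single_apply, Subtype.ext_iff]

/-- Solutions with unit vectors as class values are linearly independent, which gives the lower
bound. Injectivity of `classValues` gives the upper bound for finitely many classes; for infinitely
many the lower bound is already `⊤`, so surjectivity is never needed. -/
theorem toENat_rank_solutionSpace (o : Orientation linearAntitree) (hle : ∀ i, cls i ≤ i)
    (hid : ∀ i, cls (cls i) = cls i) (hκ : ‖κ‖ = 1) :
    Cardinal.toENat (Module.rank ℂ (solutionSpace o (classLength cls) κ)) =
      {j | cls j = j}.encard := by
  choose x hx using exists_classValues_eq o hle hid hκ
  have hli : LinearIndependent ℂ x := by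
    refine LinearIndependent.of_comp (classValues o cls κ) ?_
    rw [show (classValues o cls κ) ∘ x = fun j => Pi.single j (1 : ℂ) from funext hx]
    exact Pi.linearIndependent_single_one _ _
  have hge := hli.cardinal_le_rank
  rw [Set.encard, ENat.card]
  refine le_antisymm ?_ (OrderHomClass.mono Cardinal.toENat hge)
  rcases finite_or_infinite {j | cls j = j} with hfin | hinf
  · have := Fintype.ofFinite {j | cls j = j}
    have hle' := LinearMap.rank_le_of_injective _ (classValues_injective o hle hid hκ)
    rw [rank_fun', ← Cardinal.mk_fintype] at hle'
    exact OrderHomClass.mono Cardinal.toENat hle'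
  · rw [Cardinal.toENat_eq_top.2 (Cardinal.aleph0_le_mk _)]
    exact le_top

end

/-! ### Choice of the classes and conclusion -/

theorem exists_classification (N : ℕ∞) (hN : 1 ≤ N) : ∃ cls : ℕ → ℕ, (∀ i, cls i ≤ i) ∧
    (∀ i, cls (cls i) = cls i) ∧ {j | cls j = j}.encard = N := by
  induction N using ENat.recTopCoe with
  -- For `N = ∞` every label is its own class. For finite `n` all labels from `n - 1` on are merged
  -- into one class.
  | top => exact ⟨id, fun _ => le_rfl, fun _ => rfl, by simp⟩
  | coe n =>
    have hn : 1 ≤ n := by exact_mod_cast hN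
    refine ⟨fun i => min i (n - 1), fun i => min_le_left _ _, fun i => by simp, ?_⟩
    have : {j | min j (n - 1) = j} = (Finset.range n : Set ℕ) := by
      ext j
      simp only [mem_ofPred_eq, Finset.coe_range, mem_Iio]
      omega
    rw [this, Set.encard_coe_eq_coe_finsetCard, Finset.card_range]

/-- A square root `κ` of `-z` has modulus `1`, and this is all that the estimates use; the same
lengths therefore serve both `i` and `-i`. -/
theorem defect_minimalLaplacian {cls : ℕ → ℕ} (hle : ∀ i, cls i ≤ i)
    (hid : ∀ i, cls (cls i) = cls i) (o : Orientation linearAntitree) {z : ℂ} (hz : ‖z‖ = 1) :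
    defect (minimalLaplacian o (classLength_pos cls)) z = {j | cls j = j}.encard := by
  obtain ⟨κ, hκ⟩ := IsAlgClosed.exists_pow_nat_eq (-z) (n := 2) (by norm_num)
  have hκ1 : ‖κ‖ = 1 := by
    have := congrArg norm hκ
    rw [norm_pow, norm_neg, hz] at this
    exact (pow_eq_one_iff_of_nonneg (norm_nonneg κ) two_ne_zero).1 this
  have hκ0 : κ ≠ 0 := norm_ne_zero_iff.1 (by rw [hκ1]; exact one_ne_zero)
  obtain rfl : z = -κ ^ 2 := by rw [hκ, neg_neg]
  rw [defect, rank_deficiencySubspace_eq o (classLength_pos cls) hκ0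
    (fun e => sinSol_ne_zero hκ1 (classLength_pos cls e) (classLength_le_eighth cls e))
    neighborSet_nonempty, toENat_rank_solutionSpace o hle hid hκ1]

end QuantumGraph

end

theorem theorem7p1 (N : ℕ∞) (hN : 1 ≤ N) :
    ∃ (ℓ : (QuantumGraph.antitree (fun n => n + 1)).edgeSet → ℝ) (hℓ : ∀ e, 0 < ℓ e),
      ∀ o : QuantumGraph.Orientation (QuantumGraph.antitree (fun n => n + 1)),
        QuantumGraph.defect (QuantumGraph.minimalLaplacian o hℓ) Complex.I = N ∧
        QuantumGraph.defect (QuantumGraph.minimalLaplacian o hℓ) (-Complex.I) = N := by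
  obtain ⟨cls, hle, hid, rfl⟩ := QuantumGraph.exists_classification N hN
  exact ⟨QuantumGraph.classLength cls, QuantumGraph.classLength_pos cls, fun o =>
    ⟨QuantumGraph.defect_minimalLaplacian hle hid o (by simp),
      QuantumGraph.defect_minimalLaplacian hle hid o (by simp)⟩⟩
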